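/- \textbf{Setting.} A \emph{path category} is a category $\mathcal C$ with two classes of maps, fibrations and weak equivalences (maps in both are acyclic fibrations), such that: fibrations are closed under composition; pullbacks of (acyclic) fibrations along arbitrary maps exist and are (acyclic) fibrations; weak equivalences satisfy 2-out-of-6; isomorphisms are acyclic fibrations and every acyclic fibration has a section; every object $B$ has a path object, i.e. a factorisation of $B\to B\times B$ as a weak equivalence $r:B\to PB$ followed by a fibration $(s,t):PB\to B\times B$; there is a terminal object and every map to it is a fibration. Maps $f,g:Y\to X$ are \emph{homotopic}, $f\simeq g$, if $f=sh$, $g=th$ for some $h:Y\to PX$ into a path object; for a fibration $X\to I$ they are \emph{fibrewise homotopic over $I$} if the same holds with a factorisation $X\to P_I(X)\to X\times_I X$ of the diagonal over $I$ into a weak equivalence and a fibration. A \emph{weak homotopy exponential} of $X,Y$ is an object $X^Y$ with $\mathrm{ev}:X^Y\times Y\to X$ such that for every $h:A\times Y\to X$ there is $H:A\to X^Y$ with $\mathrm{ev}(H\times 1)\simeq h$; it is a \emph{homotopy exponential} if $H$ is moreover unique up to homotopy. $\mathcal C$ has \emph{weak homotopy $\Pi$-types} if for all fibrations $f:X\to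 J$, $\alpha:J\to I$ there are a fibration $\Pi_\alpha X\to I$ and a map $\mathrm{ev}:\alpha^*\Pi_\alpha X\to X$ over $J$ such that for all $g:Y\to I$ and $m:\alpha^*Y\to X$ over $J$ there is $n:Y\to\Pi_\alpha X$ over $I$ with $m$ and $\mathrm{ev}\circ\alpha^*n$ fibrewise homotopic over $J$. A \emph{homotopy equivalence relation} on $X$ is a fibration $\rho=(\rho_1,\rho_2):R\to X\times X$ admitting maps that witness reflexivity, symmetry and transitivity. These are the objects $(X,R)$ of the category $\mathrm{Ex}(\mathcal C)$; a morphism $(X,R)\to(Y,S)$ is a map $f:X\to Y$ for which some $\varphi:R\to S$ satisfies $\sigma\varphi=(f\times f)\rho$, where $\sigma=(\sigma_1,\sigma_2):S\to Y\times Y$. Write $f\sim g$ if $(f,g)=\sigma H$ for some $H:X\to S$. In $\mathrm{Ex}(\mathcal C)$ a map $f$ is a weak equivalence if it is invertible up to $\sim$, and a fibration if it is a fibration in $\mathcal C$ and there is $\nabla:X\times_Y S\to R$ (pullback of $f$ and $\sigma_1$) with $\rho_1\nabla=p_1$ and $f\rho_2\nabla=\sigma_2p_2$. The homotopy exact completion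 $\mathrm{Hex}(\mathcal C)$ is the quotient of $\mathrm{Ex}(\mathcal C)$ by $\sim$. \textbf{Proposition.} Let $\mathcal C$ be a path category with weak homotopy $\Pi$-types. Then (1) $\mathrm{Ex}(\mathcal C)$ has homotopy exponentials $A^B$ for all objects $A,B$ (with respect to the above fibrations and weak equivalences); (2) $\mathrm{Hex}(\mathcal C)$ has finite products and exponentials, i.e. it is cartesian closed; (3) for $A=(X,R)$ and $B=(Y,S)$ these can be constructed as follows. For a fibration $p:Z\to V$ and an object $T$, call a fibration $p^T:Z^T\to V^T$ between weak homotopy exponentials \emph{good} if $\mathrm{ev}(p^T\times 1)=p\,\mathrm{ev}$ and if for every object $U$ and all $f:U\to V^T$, $m:U\times T\to Z$ with $\mathrm{ev}(f\times1)\simeq pm$ there is $n:U\to Z^T$ with $p^Tn\simeq f$ and $\mathrm{ev}(n\times 1)\simeq m$. Choose a weak homotopy exponential $X^Y$, a good fibration $R^S\to(X\times X)^S$ for $\rho$, a map $d:X^Y\to(X\times X)^S$ with $\mathrm{ev}(d\times1_S)\simeq(\mathrm{ev}(1\times\sigma_1),\mathrm{ev}(1\times\sigma_2))$, and a good fibration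 $R^Y\to X^Y\times X^Y$ for $\rho$, where $X^Y\times X^Y$ with the pairing of the two evaluations serves as $(X\times X)^Y$. Let $W$, with projection $p:W\to X^Y$, be the pullback of $d$ and $R^S\to(X\times X)^S$, and let $Q\to W\times W$ be the pullback of $R^Y\to X^Y\times X^Y$ along $p\times p$. Such choices exist, and for every such choice $Q\to W\times W$ is a homotopy equivalence relation, $\mathrm{ev}\circ(p\times1):W\times Y\to X$ is a morphism $(W,Q)\times(Y,S)\to(X,R)$ of $\mathrm{Ex}(\mathcal C)$ which makes $(W,Q)$ a homotopy exponential $A^B$ in $\mathrm{Ex}(\mathcal C)$, and its class makes $(W,Q)$ an exponential $A^B$ in $\mathrm{Hex}(\mathcal C)$. -/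

import Mathlib

open CategoryTheory CategoryTheory.Limits

universe v u

namespace PathCat

attribute [local simp] prod.lift_fst prod.lift_snd prod.lift_fst_assoc prod.lift_snd_assoc
  pullback.lift_fst pullback.lift_snd pullback.lift_fst_assoc pullback.lift_snd_assoc

/-! ### Path categories -/

/-- A category with two distinguished classes of maps, fibrations and weak equivalences
(no axioms yet). -/
class FibWeq (C : Type u) [Category.{v} C] where
  /-- the fibrations -/
  fib : MorphismProperty C
  /-- the weak equivalences -/
  weq : MorphismProperty C

open FibWeq (fib weq)

/-- The axioms of a path category other than the existence of path objects. They are separated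
only because they already provide the products `B ⨯ B` in terms of which path objects are
defined. -/
class PrePathCategory (C : Type u) [Category.{v} C] [FibWeq C] : Prop where
  /-- Fibrations are closed under composition. -/
  fib_comp : ∀ {X Y Z : C} (f : X ⟶ Y) (g : Y ⟶ Z), fib f → fib g → fib (f ≫ g)
  /-- The pullback of a fibration along any other map exists ... -/
  hasPullback : ∀ {X Y Z : C} (p : X ⟶ Y) (f : Z ⟶ Y), fib p → HasPullback p f
  /-- ... and is again a fibration. -/
  fib_pullback : ∀ {P X Y Z : C} {p' : P ⟶ X} {f' : P ⟶ Z} {p : X ⟶ Y} {f : Z ⟶ Y},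
    IsPullback p' f' p f → fib p → fib f'
  /-- The pullback of an acyclic fibration is again an acyclic fibration. -/
  acyclic_pullback : ∀ {P X Y Z : C} {p' : P ⟶ X} {f' : P ⟶ Z} {p : X ⟶ Y} {f : Z ⟶ Y},
    IsPullback p' f' p f → fib p → weq p → fib f' ∧ weq f'
  /-- Weak equivalences satisfy 2-out-of-6. -/
  two_of_six : ∀ {X Y Z W : C} (f : X ⟶ Y) (g : Y ⟶ Z) (h : Z ⟶ W),
    weq (f ≫ g) → weq (g ≫ h) → weq f ∧ weq g ∧ weq h ∧ weq (f ≫ g ≫ h)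
  /-- Isomorphisms are acyclic fibrations ... -/
  iso_acyclic : ∀ {X Y : C} (f : X ⟶ Y), IsIso f → fib f ∧ weq f
  /-- ... and every acyclic fibration has a section. -/
  acyclic_section : ∀ {X Y : C} (f : X ⟶ Y), fib f → weq f → ∃ s : Y ⟶ X, s ≫ f = 𝟙 Y
  /-- There is a terminal object ... -/
  hasTerminal : HasTerminal C
  /-- ... and every map to the terminal object is a fibration. -/
  fib_terminal : ∀ {X T : C} (f : X ⟶ T), IsTerminal T → fib f

/-- A path category has binary products (as pullbacks over the terminal object). -/
instance hasBinaryProducts_of_pre (C : Type u) [Category.{v} C] [FibWeq C]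
    [PrePathCategory C] : HasBinaryProducts C := by
  have : HasTerminal C := PrePathCategory.hasTerminal
  have key : ∀ X Y : C, HasBinaryProduct X Y := fun X Y => by
    have : HasPullback (terminal.from X) (terminal.from Y) :=
      PrePathCategory.hasPullback _ _ (PrePathCategory.fib_terminal _ terminalIsTerminal)
    refine HasLimit.mk ⟨BinaryFan.mk (pullback.fst (terminal.from X) (terminal.from Y))
      (pullback.snd _ _), BinaryFan.isLimitMk
        (fun s => pullback.lift (f := terminal.from X) (g := terminal.from Y) s.fst s.snd
          (Subsingleton.elim _ _)) ?_ ?_ ?_⟩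
    · exact fun s => pullback.lift_fst _ _ _
    · exact fun s => pullback.lift_snd _ _ _
    · intro s m h₁ h₂
      refine pullback.hom_ext ?_ ?_
      · exact h₁.trans (pullback.lift_fst (f := terminal.from X) (g := terminal.from Y)
          s.fst s.snd (Subsingleton.elim _ _)).symm
      · exact h₂.trans (pullback.lift_snd (f := terminal.from X) (g := terminal.from Y)
          s.fst s.snd (Subsingleton.elim _ _)).symm
  exact hasBinaryProducts_of_hasLimit_pair C

section Homotopy

variable {C : Type u} [Category.{v} C] [FibWeq C]

/-- A path object on `B`: a factorisation of the diagonal `B ⟶ B ⨯ B` as a weak equivalence `r`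
followed by a fibration `(s, t)`. -/
structure PathObject [HasBinaryProducts C] (B : C) where
  obj : C
  r : B ⟶ obj
  s : obj ⟶ B
  t : obj ⟶ B
  fac : r ≫ prod.lift s t = diag B
  weq_r : weq r
  fib_st : fib (prod.lift s t)

/-- Two parallel maps are homotopic if there is a homotopy between them with respect to some path
object on the codomain. -/
def Homotopic [HasBinaryProducts C] {Y X : C} (f g : Y ⟶ X) : Prop :=
  ∃ (P : PathObject X) (h : Y ⟶ P.obj), h ≫ P.s = f ∧ h ≫ P.t = g

/-- A path object of `X` over `I`, for a map `p : X ⟶ I`: a factorisation of the diagonal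
`X ⟶ X ×_I X` as a weak equivalence `r` followed by a fibration `st`. -/
structure FibrewisePathObject {X I : C} (p : X ⟶ I) where
  obj : C
  /-- the fibre product `X ×_I X` -/
  prod : C
  fst : prod ⟶ X
  snd : prod ⟶ X
  isPullback : IsPullback fst snd p p
  r : X ⟶ obj
  st : obj ⟶ prod
  fac_fst : r ≫ st ≫ fst = 𝟙 X
  fac_snd : r ≫ st ≫ snd = 𝟙 X
  weq_r : weq r
  fib_st : fib st

/-- Two parallel maps into `X` are fibrewise homotopic over `I`, with respect to a fibration
`p : X ⟶ I`. (This forces `f ≫ p = g ≫ p`.) -/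
def FibrewiseHomotopic {Y X I : C} (p : X ⟶ I) (f g : Y ⟶ X) : Prop :=
  ∃ (P : FibrewisePathObject p) (h : Y ⟶ P.obj), h ≫ P.st ≫ P.fst = f ∧ h ≫ P.st ≫ P.snd = g

/-! ### Exponentials and weak homotopy Π-types -/

/-- `ev : E ⨯ Y ⟶ X` makes `E` a weak homotopy exponential `X ^ Y`. -/
def IsWeakHomotopyExponential [HasBinaryProducts C] {X Y E : C} (ev : E ⨯ Y ⟶ X) : Prop :=
  ∀ (A : C) (h : A ⨯ Y ⟶ X), ∃ H : A ⟶ E, Homotopic (prod.map H (𝟙 Y) ≫ ev) h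

/-- `ev : E ⨯ Y ⟶ X` makes `E` a homotopy exponential `X ^ Y`: a weak homotopy exponential for
which the transposes are unique up to homotopy. -/
def IsHomotopyExponential [HasBinaryProducts C] {X Y E : C} (ev : E ⨯ Y ⟶ X) : Prop :=
  IsWeakHomotopyExponential ev ∧
  ∀ (A : C) (h : A ⨯ Y ⟶ X) (H H' : A ⟶ E),
    Homotopic (prod.map H (𝟙 Y) ≫ ev) h → Homotopic (prod.map H' (𝟙 Y) ≫ ev) h →
      Homotopic H H'

end Homotopy

/-- Existence of homotopy exponentials `X ^ Y` for all objects `X` and `Y`. -/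
def HasHomotopyExponentials (C : Type u) [Category.{v} C] [FibWeq C] [HasBinaryProducts C] :
    Prop :=
  ∀ X Y : C, ∃ (E : C) (ev : E ⨯ Y ⟶ X), IsHomotopyExponential ev

/-- `ev : E ⨯ Y ⟶ X` makes `E` an exponential `X ^ Y` in the ordinary sense. -/
def IsExponential {C : Type u} [Category.{v} C] [HasBinaryProducts C] {X Y E : C}
    (ev : E ⨯ Y ⟶ X) : Prop :=
  ∀ (A : C) (h : A ⨯ Y ⟶ X), ∃! H : A ⟶ E, prod.map H (𝟙 Y) ≫ ev = h

/-- Weak homotopy Π-types: for fibrations `f : X ⟶ J` and `α : J ⟶ I` there are a fibration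
`π : P ⟶ I` (with pullback `αP = α^* P`, projections `a` and `b`) and an evaluation
`ev : α^* P ⟶ X` over `J` such that for all `g : Y ⟶ I` and `m : α^* Y ⟶ X` over `J` there is
`n : Y ⟶ P` over `I` with `m` and `α^* n ≫ ev` fibrewise homotopic over `J`; here
`k = α^* n`. -/
def HasWeakHomotopyPi (C : Type u) [Category.{v} C] [FibWeq C] : Prop :=
  ∀ {X J I : C} (f : X ⟶ J) (α : J ⟶ I), fib f → fib α →
    ∃ (P : C) (π : P ⟶ I) (αP : C) (a : αP ⟶ J) (b : αP ⟶ P) (ev : αP ⟶ X),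
      fib π ∧ IsPullback a b α π ∧ ev ≫ f = a ∧
      ∀ (Y : C) (g : Y ⟶ I) (αY : C) (a' : αY ⟶ J) (b' : αY ⟶ Y), IsPullback a' b' α g →
        ∀ m : αY ⟶ X, m ≫ f = a' →
          ∃ (n : Y ⟶ P) (k : αY ⟶ αP), n ≫ π = g ∧ k ≫ a = a' ∧ k ≫ b = b' ≫ n ∧
            FibrewiseHomotopic f m (k ≫ ev)

/-- A path category. -/
class PathCategory (C : Type u) [Category.{v} C] [FibWeq C] : Prop
    extends PrePathCategory C where
  /-- Every object has a path object. -/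
  hasPathObject : ∀ B : C, Nonempty (PathObject B)

section FibLemmas

variable {C : Type u} [Category.{v} C] [FibWeq C] [PrePathCategory C]

theorem fib_of_isIso {X Y : C} (f : X ⟶ Y) [IsIso f] : fib f :=
  (PrePathCategory.iso_acyclic f inferInstance).1

theorem fib_fst (X Y : C) : fib (prod.fst : X ⨯ Y ⟶ X) := by
  have : HasTerminal C := PrePathCategory.hasTerminal
  have h : IsPullback (prod.snd : X ⨯ Y ⟶ Y) (prod.fst : X ⨯ Y ⟶ X)
      (terminal.from Y) (terminal.from X) :=
    IsPullback.of_isLimit_binaryFan_of_isTerminal (prodIsProd X Y) terminalIsTerminal |>.flip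
  exact PrePathCategory.fib_pullback h (PrePathCategory.fib_terminal _ terminalIsTerminal)

theorem fib_snd (X Y : C) : fib (prod.snd : X ⨯ Y ⟶ Y) := by
  have h : (prod.snd : X ⨯ Y ⟶ Y) = (prod.braiding X Y).hom ≫ prod.fst := by simp
  rw [h]
  exact PrePathCategory.fib_comp _ _ (fib_of_isIso _) (fib_fst _ _)

theorem fib_map_id {X Y : C} (Z : C) {f : X ⟶ Y} (hf : fib f) : fib (prod.map f (𝟙 Z)) := by
  have h : IsPullback (prod.fst : X ⨯ Z ⟶ X) (prod.map f (𝟙 Z)) f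
      (prod.fst : Y ⨯ Z ⟶ Y) := by
    refine ⟨⟨by simp⟩, ⟨PullbackCone.IsLimit.mk _
      (fun s => prod.lift s.fst (s.snd ≫ prod.snd)) ?_ ?_ ?_⟩⟩
    · intro s; simp
    · intro s
      ext
      · simpa using s.condition
      · simp
    · intro s m h₁ h₂
      ext
      · simpa using h₁
      · simp [← h₂]
  exact PrePathCategory.fib_pullback h hf

theorem fib_map {X Y X' Y' : C} {f : X ⟶ Y} {g : X' ⟶ Y'} (hf : fib f) (hg : fib g) :
    fib (prod.map f g) := by
  have h : prod.map f g = prod.map f (𝟙 X') ≫ (prod.braiding Y X').hom ≫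
      prod.map g (𝟙 Y) ≫ (prod.braiding Y' Y).hom := by
    ext <;> simp
  rw [h]
  exact PrePathCategory.fib_comp _ _ (fib_map_id _ hf) (PrePathCategory.fib_comp _ _
    (fib_of_isIso _) (PrePathCategory.fib_comp _ _ (fib_map_id _ hg) (fib_of_isIso _)))

end FibLemmas

/-! ### Homotopy equivalence relations, `Ex` and `Hex` -/

/-- A fibration `(p₁, p₂) : R ⟶ X ⨯ X` which is a homotopy equivalence relation. -/
structure IsHomotopyEquivRel {C : Type u} [Category.{v} C] [FibWeq C] [HasBinaryProducts C]
    {X R : C} (p₁ p₂ : R ⟶ X) : Prop where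
  fib_lift : fib (prod.lift p₁ p₂)
  refl : ∃ ρ : X ⟶ R, ρ ≫ prod.lift p₁ p₂ = diag X
  symm : ∃ σ : R ⟶ R, σ ≫ p₁ = p₂ ∧ σ ≫ p₂ = p₁
  trans : ∀ {Q : C} (q₁ q₂ : Q ⟶ R), IsPullback q₁ q₂ p₂ p₁ →
    ∃ τ : Q ⟶ R, τ ≫ p₁ = q₁ ≫ p₁ ∧ τ ≫ p₂ = q₂ ≫ p₂

/-- The objects of `Ex C` (and of `Hex C`): homotopy equivalence relations in `C`. -/
structure Ex (C : Type u) [Category.{v} C] [FibWeq C] [PrePathCategory C] where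
  /-- the carrier -/
  X : C
  /-- the object of the relation -/
  R : C
  p₁ : R ⟶ X
  p₂ : R ⟶ X
  isRel : IsHomotopyEquivRel p₁ p₂

namespace Ex

variable {C : Type u} [Category.{v} C] [FibWeq C] [PrePathCategory C]

/-- The fibration `R ⟶ X ⨯ X` of a homotopy equivalence relation. -/
noncomputable abbrev rel (A : Ex C) : A.R ⟶ A.X ⨯ A.X := prod.lift A.p₁ A.p₂

/-- A morphism of `Ex C`: a map of carriers for which there exists a tracking. -/
@[ext]
structure Hom (A B : Ex C) where
  hom : A.X ⟶ B.X
  tracked : ∃ φ : A.R ⟶ B.R, φ ≫ B.rel = A.rel ≫ prod.map hom hom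

instance : Category.{v} (Ex C) where
  Hom A B := Hom A B
  id A := ⟨𝟙 A.X, 𝟙 A.R, by simp⟩
  comp f g := ⟨f.hom ≫ g.hom, by
    obtain ⟨φ, hφ⟩ := f.tracked
    obtain ⟨ψ, hψ⟩ := g.tracked
    exact ⟨φ ≫ ψ, by rw [Category.assoc, hψ, ← Category.assoc, hφ]; simp⟩⟩
  id_comp f := by ext; simp
  comp_id f := by ext; simp
  assoc f g h := by ext; simp

@[ext]
theorem hom_ext {A B : Ex C} {f g : A ⟶ B} (h : f.hom = g.hom) : f = g := Hom.ext h

@[simp]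
theorem id_hom (A : Ex C) : Hom.hom (𝟙 A) = 𝟙 A.X := rfl

@[simp]
theorem comp_hom {A B D : Ex C} (f : A ⟶ B) (g : B ⟶ D) : (f ≫ g).hom = f.hom ≫ g.hom := rfl

/-- The relation `f ∼ g` on parallel maps `(X, R) ⟶ (Y, S)`: there is `H : X ⟶ S` with
`(f, g) = H ≫ σ`. -/
def homRel (C : Type u) [Category.{v} C] [FibWeq C] [PrePathCategory C] : HomRel (Ex C) :=
  fun A B f g => ∃ H : A.X ⟶ B.R, H ≫ B.rel = prod.lift f.hom g.hom

theorem homRel_iff {A B : Ex C} (f g : A ⟶ B) :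
    homRel C f g ↔ ∃ H : A.X ⟶ B.R, H ≫ B.p₁ = f.hom ∧ H ≫ B.p₂ = g.hom := by
  constructor
  · rintro ⟨H, hH⟩
    exact ⟨H, by simpa using hH =≫ prod.fst, by simpa using hH =≫ prod.snd⟩
  · rintro ⟨H, h₁, h₂⟩
    exact ⟨H, by ext <;> simp [h₁, h₂]⟩

theorem tracked_iff {A B : Ex C} (f : A.X ⟶ B.X) :
    (∃ φ : A.R ⟶ B.R, φ ≫ B.rel = A.rel ≫ prod.map f f) ↔
      ∃ φ : A.R ⟶ B.R, φ ≫ B.p₁ = A.p₁ ≫ f ∧ φ ≫ B.p₂ = A.p₂ ≫ f := by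
  constructor
  · rintro ⟨φ, hφ⟩
    exact ⟨φ, by simpa using hφ =≫ prod.fst, by simpa using hφ =≫ prod.snd⟩
  · rintro ⟨φ, h₁, h₂⟩
    exact ⟨φ, by ext <;> simp [h₁, h₂]⟩

theorem fib_p₁ (A : Ex C) : fib A.p₁ := by
  have h : A.p₁ = A.rel ≫ prod.fst := by simp
  rw [h]
  exact PrePathCategory.fib_comp _ _ A.isRel.fib_lift (fib_fst _ _)

theorem hasPullback_p₂_p₁ (A : Ex C) : HasPullback A.p₂ A.p₁ := by
  have : HasPullback A.p₁ A.p₂ := PrePathCategory.hasPullback _ _ A.fib_p₁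
  exact hasPullback_symmetry _ _

/-- `∼` is a congruence, so that the quotient below makes no further identifications. -/
instance : Congruence (homRel C) where
  comp_left f g g' h := by
    obtain ⟨H, h₁, h₂⟩ := (homRel_iff _ _).1 h
    exact (homRel_iff _ _).2 ⟨f.hom ≫ H, by simp [h₁], by simp [h₂]⟩
  comp_right g h := by
    obtain ⟨H, h₁, h₂⟩ := (homRel_iff _ _).1 h
    obtain ⟨φ, e₁, e₂⟩ := (tracked_iff _).1 g.tracked
    exact (homRel_iff _ _).2
      ⟨H ≫ φ, by simp [e₁, reassoc_of% h₁], by simp [e₂, reassoc_of% h₂]⟩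
  equivalence {A B} :=
    { refl := fun f => by
        obtain ⟨ρ, hρ⟩ := B.isRel.refl
        have h₁ : ρ ≫ B.p₁ = 𝟙 _ := by simpa using hρ =≫ prod.fst
        have h₂ : ρ ≫ B.p₂ = 𝟙 _ := by simpa using hρ =≫ prod.snd
        exact (homRel_iff _ _).2 ⟨f.hom ≫ ρ, by simp [h₁], by simp [h₂]⟩
      symm := fun {f g} h => by
        obtain ⟨H, h₁, h₂⟩ := (homRel_iff _ _).1 h
        obtain ⟨σ, e₁, e₂⟩ := B.isRel.symm
        exact (homRel_iff _ _).2 ⟨H ≫ σ, by simp [e₁, h₂], by simp [e₂, h₁]⟩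
      trans := fun {f g k} h h' => by
        obtain ⟨H, h₁, h₂⟩ := (homRel_iff _ _).1 h
        obtain ⟨H', h₁', h₂'⟩ := (homRel_iff _ _).1 h'
        have := B.hasPullback_p₂_p₁
        obtain ⟨τ, e₁, e₂⟩ := B.isRel.trans _ _ (IsPullback.of_hasPullback B.p₂ B.p₁)
        exact (homRel_iff _ _).2 ⟨pullback.lift H H' (by rw [h₂, h₁']) ≫ τ,
          by simp [e₁, h₁], by simp [e₂, h₂']⟩ }

/-- The fibrations of `Ex C` are the maps that are fibrations in `C` and carry a weak connection
structure `∇`; the weak equivalences are the maps that are invertible up to `∼`. -/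
instance : FibWeq (Ex C) where
  fib A B f := fib f.hom ∧
    ∃ (P : C) (q₁ : P ⟶ A.X) (q₂ : P ⟶ B.R), IsPullback q₁ q₂ f.hom B.p₁ ∧
      ∃ conn : P ⟶ A.R, conn ≫ A.p₁ = q₁ ∧ conn ≫ A.p₂ ≫ f.hom = q₂ ≫ B.p₂
  weq A B f := ∃ g : B ⟶ A, homRel C (g ≫ f) (𝟙 B) ∧ homRel C (f ≫ g) (𝟙 A)

/-- The product of two homotopy equivalence relations: `R ⨯ S` over `X ⨯ Y`. -/
noncomputable def prodObj (A B : Ex C) : Ex C where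
  X := A.X ⨯ B.X
  R := A.R ⨯ B.R
  p₁ := prod.map A.p₁ B.p₁
  p₂ := prod.map A.p₂ B.p₂
  isRel := by
    refine ⟨?_, ?_, ?_, ?_⟩
    · let e : (A.X ⨯ A.X) ⨯ (B.X ⨯ B.X) ≅ (A.X ⨯ B.X) ⨯ (A.X ⨯ B.X) :=
        { hom := prod.lift (prod.map prod.fst prod.fst) (prod.map prod.snd prod.snd)
          inv := prod.lift (prod.map prod.fst prod.fst) (prod.map prod.snd prod.snd)
          hom_inv_id := by ext <;> simp
          inv_hom_id := by ext <;> simp }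
      have h : prod.lift (prod.map A.p₁ B.p₁) (prod.map A.p₂ B.p₂) =
          prod.map A.rel B.rel ≫ e.hom := by
        ext <;> simp [e]
      rw [h]
      exact PrePathCategory.fib_comp _ _ (fib_map A.isRel.fib_lift B.isRel.fib_lift)
        (PrePathCategory.iso_acyclic _ e.isIso_hom).1
    · obtain ⟨ρ, hρ⟩ := A.isRel.refl
      obtain ⟨ρ', hρ'⟩ := B.isRel.refl
      have h₁ : ρ ≫ A.p₁ = 𝟙 _ := by simpa using hρ =≫ prod.fst
      have h₂ : ρ ≫ A.p₂ = 𝟙 _ := by simpa using hρ =≫ prod.snd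
      have h₁' : ρ' ≫ B.p₁ = 𝟙 _ := by simpa using hρ' =≫ prod.fst
      have h₂' : ρ' ≫ B.p₂ = 𝟙 _ := by simpa using hρ' =≫ prod.snd
      exact ⟨prod.map ρ ρ', by ext <;> simp [h₁, h₂, h₁', h₂']⟩
    · obtain ⟨σ, h₁, h₂⟩ := A.isRel.symm
      obtain ⟨σ', h₁', h₂'⟩ := B.isRel.symm
      exact ⟨prod.map σ σ', by simp [h₁, h₁'], by simp [h₂, h₂']⟩
    · intro Q q₁ q₂ hQ
      have := A.hasPullback_p₂_p₁
      have := B.hasPullback_p₂_p₁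
      obtain ⟨τ, e₁, e₂⟩ := A.isRel.trans _ _ (IsPullback.of_hasPullback A.p₂ A.p₁)
      obtain ⟨τ', e₁', e₂'⟩ := B.isRel.trans _ _ (IsPullback.of_hasPullback B.p₂ B.p₁)
      have w₁ : (q₁ ≫ prod.fst) ≫ A.p₂ = (q₂ ≫ prod.fst) ≫ A.p₁ := by
        simpa using hQ.w =≫ prod.fst
      have w₂ : (q₁ ≫ prod.snd) ≫ B.p₂ = (q₂ ≫ prod.snd) ≫ B.p₁ := by
        simpa using hQ.w =≫ prod.snd
      exact ⟨prod.lift (pullback.lift _ _ w₁ ≫ τ) (pullback.lift _ _ w₂ ≫ τ'),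
        by ext <;> simp [e₁, e₁'], by ext <;> simp [e₂, e₂']⟩

/-- First projection of the product. -/
noncomputable def prodFst (A B : Ex C) : prodObj A B ⟶ A :=
  ⟨prod.fst, (tracked_iff (A := prodObj A B) (B := A) prod.fst).2
    ⟨prod.fst, (prod.map_fst _ _).symm, (prod.map_fst _ _).symm⟩⟩

/-- Second projection of the product. -/
noncomputable def prodSnd (A B : Ex C) : prodObj A B ⟶ B :=
  ⟨prod.snd, (tracked_iff (A := prodObj A B) (B := B) prod.snd).2
    ⟨prod.snd, (prod.map_snd _ _).symm, (prod.map_snd _ _).symm⟩⟩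

/-- Pairing into the product. -/
noncomputable def prodLift {A B D : Ex C} (f : D ⟶ A) (g : D ⟶ B) : D ⟶ prodObj A B :=
  ⟨prod.lift f.hom g.hom, (tracked_iff _).2 (by
    obtain ⟨φ, h₁, h₂⟩ := (tracked_iff _).1 f.tracked
    obtain ⟨ψ, h₁', h₂'⟩ := (tracked_iff _).1 g.tracked
    refine ⟨prod.lift φ ψ, ?_, ?_⟩
    · apply prod.hom_ext <;> simp [prodObj, h₁, h₁']
    · apply prod.hom_ext <;> simp [prodObj, h₂, h₂'])⟩

theorem prodLift_fst {A B D : Ex C} (f : D ⟶ A) (g : D ⟶ B) :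
    prodLift f g ≫ prodFst A B = f :=
  hom_ext (prod.lift_fst _ _)

theorem prodLift_snd {A B D : Ex C} (f : D ⟶ A) (g : D ⟶ B) :
    prodLift f g ≫ prodSnd A B = g :=
  hom_ext (prod.lift_snd _ _)

theorem prod_hom_ext {A B D : Ex C} {f g : D ⟶ prodObj A B}
    (h₁ : f ≫ prodFst A B = g ≫ prodFst A B) (h₂ : f ≫ prodSnd A B = g ≫ prodSnd A B) :
    f = g :=
  hom_ext (prod.hom_ext (congrArg Hom.hom h₁) (congrArg Hom.hom h₂))

/-- `prodObj A B` is a product of `A` and `B`. -/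
noncomputable def prodIsLimit (A B : Ex C) :
    IsLimit (BinaryFan.mk (prodFst A B) (prodSnd A B)) :=
  BinaryFan.isLimitMk (fun s => prodLift s.fst s.snd)
    (fun s => prodLift_fst s.fst s.snd) (fun s => prodLift_snd s.fst s.snd)
    (fun s _ h₁ h₂ => prod_hom_ext (h₁.trans (prodLift_fst s.fst s.snd).symm)
      (h₂.trans (prodLift_snd s.fst s.snd).symm))

instance : HasBinaryProducts (Ex C) :=
  have : ∀ {A B : Ex C}, HasLimit (pair A B) := fun {A B} => HasLimit.mk ⟨_, prodIsLimit A B⟩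
  hasBinaryProducts_of_hasLimit_pair (Ex C)

end Ex

/-- The homotopy exact completion of `C`: the objects are those of `Ex C`, the morphisms are the
equivalence classes of morphisms of `Ex C` under `∼`. -/
abbrev Hex (C : Type u) [Category.{v} C] [FibWeq C] [PrePathCategory C] : Type max u v :=
  CategoryTheory.Quotient (Ex.homRel C)

namespace Hex

variable {C : Type u} [Category.{v} C] [FibWeq C] [PrePathCategory C]

/-- The quotient functor `Ex C ⥤ Hex C`. -/
abbrev q (C : Type u) [Category.{v} C] [FibWeq C] [PrePathCategory C] : Ex C ⥤ Hex C :=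
  CategoryTheory.Quotient.functor (Ex.homRel C)

theorem q_eq_iff {A B : Ex C} (f g : A ⟶ B) :
    (q C).map f = (q C).map g ↔ Ex.homRel C f g :=
  CategoryTheory.Quotient.functor_map_eq_iff _ _ _

/-- The quotient functor sends the products of `Ex C` to products. -/
theorem nonempty_prodIsLimit (A B : Ex C) :
    Nonempty (IsLimit (BinaryFan.mk ((q C).map (Ex.prodFst A B))
      ((q C).map (Ex.prodSnd A B)))) := by
  have lift : ∀ {T : Hex C} (f : T ⟶ (q C).obj A) (g : T ⟶ (q C).obj B),
      ∃ l : T ⟶ (q C).obj (Ex.prodObj A B), l ≫ (q C).map (Ex.prodFst A B) = f ∧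
        l ≫ (q C).map (Ex.prodSnd A B) = g := by
    rintro ⟨T⟩ f g
    obtain ⟨f, rfl⟩ := (q C).map_surjective (X := T) f
    obtain ⟨g, rfl⟩ := (q C).map_surjective (X := T) g
    refine ⟨(q C).map (Ex.prodLift f g), ?_, ?_⟩
    · erw [← (q C).map_comp]
      congr 1
      exact Ex.prodLift_fst f g
    · erw [← (q C).map_comp]
      congr 1
      exact Ex.prodLift_snd f g
  have uniq : ∀ {T : Hex C} (l l' : T ⟶ (q C).obj (Ex.prodObj A B)),
      l ≫ (q C).map (Ex.prodFst A B) = l' ≫ (q C).map (Ex.prodFst A B) →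
      l ≫ (q C).map (Ex.prodSnd A B) = l' ≫ (q C).map (Ex.prodSnd A B) → l = l' := by
    rintro ⟨T⟩ l l' h₁ h₂
    obtain ⟨l, rfl⟩ := (q C).map_surjective (X := T) l
    obtain ⟨l', rfl⟩ := (q C).map_surjective (X := T) l'
    erw [← (q C).map_comp, ← (q C).map_comp, q_eq_iff, Ex.homRel_iff] at h₁ h₂
    obtain ⟨H, a₁, a₂⟩ := h₁
    obtain ⟨K, b₁, b₂⟩ := h₂
    rw [q_eq_iff, Ex.homRel_iff]
    refine ⟨prod.lift H K, ?_, ?_⟩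
    · apply prod.hom_ext
      · exact (show (prod.lift H K ≫ prod.map A.p₁ B.p₁) ≫ prod.fst = H ≫ A.p₁ by
          simp).trans a₁
      · exact (show (prod.lift H K ≫ prod.map A.p₁ B.p₁) ≫ prod.snd = K ≫ B.p₁ by
          simp).trans b₁
    · apply prod.hom_ext
      · exact (show (prod.lift H K ≫ prod.map A.p₂ B.p₂) ≫ prod.fst = H ≫ A.p₂ by
          simp).trans a₂
      · exact (show (prod.lift H K ≫ prod.map A.p₂ B.p₂) ≫ prod.snd = K ≫ B.p₂ by
          simp).trans b₂
  exact ⟨BinaryFan.isLimitMk (fun s => (lift s.fst s.snd).choose)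
    (fun s => (lift s.fst s.snd).choose_spec.1) (fun s => (lift s.fst s.snd).choose_spec.2)
    (fun s m h₁ h₂ => uniq _ _ (h₁.trans (lift s.fst s.snd).choose_spec.1.symm)
      (h₂.trans (lift s.fst s.snd).choose_spec.2.symm))⟩

instance : HasBinaryProducts (Hex C) :=
  have : ∀ {A B : Hex C}, HasLimit (pair A B) := fun {A B} =>
    HasLimit.mk ⟨_, (nonempty_prodIsLimit A.as B.as).some⟩
  hasBinaryProducts_of_hasLimit_pair (Hex C)

end Hex

/-! ### The explicit construction -/

section Construction

variable {C : Type u} [Category.{v} C] [FibWeq C] [PrePathCategory C]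

/-- For a fibration `p : Z ⟶ Y` and an object `X`, the map `pX : ZX ⟶ YX` between weak homotopy
exponentials `YX = Y ^ X` and `ZX = Z ^ X` is a fibration which strictly commutes with the
evaluations, and the map from `Ho(T, ZX)` to the pullback of
`Ho(T, YX) ⟶ Ho(T ⨯ X, Y) ⟵ Ho(T ⨯ X, Z)` is surjective for every `T`. -/
structure IsFibrationOfExponentials {X Y Z YX ZX : C} (p : Z ⟶ Y) (evY : YX ⨯ X ⟶ Y)
    (evZ : ZX ⨯ X ⟶ Z) (pX : ZX ⟶ YX) : Prop where
  weakY : IsWeakHomotopyExponential evY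
  weakZ : IsWeakHomotopyExponential evZ
  fib_pX : fib pX
  comm : prod.map pX (𝟙 X) ≫ evY = evZ ≫ p
  surj : ∀ (T : C) (f : T ⟶ YX) (m : T ⨯ X ⟶ Z),
    Homotopic (prod.map f (𝟙 X) ≫ evY) (m ≫ p) →
      ∃ n : T ⟶ ZX, Homotopic (n ≫ pX) f ∧ Homotopic (prod.map n (𝟙 X) ≫ evZ) m

/-- The choices that are made in the construction of the exponential `A ^ B` of the homotopy
equivalence relations `A = (X, R)` and `B = (Y, S)`. -/
structure ExpData (A B : Ex C) where
  /-- a weak homotopy exponential `X ^ Y` -/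
  E : C
  ev : E ⨯ B.X ⟶ A.X
  weak : IsWeakHomotopyExponential ev
  /-- a weak homotopy exponential `(X ⨯ X) ^ S` and a fibration `R ^ S ⟶ (X ⨯ X) ^ S` -/
  D : C
  evD : D ⨯ B.R ⟶ A.X ⨯ A.X
  RS : C
  evRS : RS ⨯ B.R ⟶ A.R
  k : RS ⟶ D
  isFibS : IsFibrationOfExponentials A.rel evD evRS k
  /-- a map `X ^ Y ⟶ (X ⨯ X) ^ S` that represents, up to homotopy, the operation which sends
  `f` to `s ↦ (f (σ₁ s), f (σ₂ s))` -/
  d : E ⟶ D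
  d_comm : Homotopic (prod.map d (𝟙 B.R) ≫ evD)
    (prod.lift (prod.map (𝟙 E) B.p₁ ≫ ev) (prod.map (𝟙 E) B.p₂ ≫ ev))
  /-- the pullback `W` of `X ^ Y ⟶ (X ⨯ X) ^ S ⟵ R ^ S` -/
  W : C
  p : W ⟶ E
  w : W ⟶ RS
  isPullbackW : IsPullback p w d k
  /-- a fibration `R ^ Y ⟶ (X ⨯ X) ^ Y = X ^ Y ⨯ X ^ Y` -/
  RY : C
  evRY : RY ⨯ B.X ⟶ A.R
  l : RY ⟶ E ⨯ E
  isFibY : IsFibrationOfExponentials A.rel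
    (prod.lift (prod.map prod.fst (𝟙 B.X) ≫ ev) (prod.map prod.snd (𝟙 B.X) ≫ ev)) evRY l
  /-- the pullback `Q` of `W ⨯ W ⟶ X ^ Y ⨯ X ^ Y ⟵ R ^ Y` -/
  Q : C
  q₁ : Q ⟶ W
  q₂ : Q ⟶ W
  qR : Q ⟶ RY
  isPullbackQ : IsPullback (prod.lift q₁ q₂) qR (prod.map p p) l

/-- The object `(W, Q)`, given that `Q` is a homotopy equivalence relation on `W`. -/
def ExpData.obj {A B : Ex C} (c : ExpData A B) (h : IsHomotopyEquivRel c.q₁ c.q₂) : Ex C :=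
  ⟨c.W, c.Q, c.q₁, c.q₂, h⟩

end Construction

end PathCat

open PathCat

/-! A relation `A.R` is studied through its generalised elements: for every object `T` it gives an
equivalence relation `A.Rel` on maps `T ⟶ A.X`, stable under precomposition and preserved by
morphisms of `Ex C`. Because `A.rel` is a fibration and the relation is reflexive, homotopic maps
are related (`Ex.Rel.of_homotopic`). Hence data that exist in `C` only up to homotopy become correct
up to `∼`.

In these terms the construction says what one expects. A map into `X ^ Y` lifts to `W` exactly when
its transpose sends `S`-related arguments to `R`-related values (`exists_lift_k_iff`). Two maps into
`W` are `Q`-related exactly when their transposes are `R`-related pointwise (`exists_lift_q_iff`).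
So `Q` inherits the equivalence relation axioms from `R`, and evaluation respects the relations. A
transpose chosen by the weak exponential of `C` is related to a morphism, hence lifts to `W` and
preserves relations. Uniqueness up to `∼` is the definition of `Q`.

Two comparisons finish the argument. In `Ex C` homotopy coincides with `∼` (`homotopic_iff_homRel`),
so this is a homotopy exponential. The quotient functor preserves binary products and turns `∼` into
equality, so it becomes an ordinary exponential in `Hex C`. The required choices exist by weak
`Π`-types along projections, together with pullbacks of fibrations. -/

namespace PathCat

open PathCat.FibWeq (fib weq)

attribute [local simp] prod.lift_fst prod.lift_snd prod.lift_fst_assoc prod.lift_snd_assoc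
  pullback.lift_fst pullback.lift_snd pullback.lift_fst_assoc pullback.lift_snd_assoc

/-! ### Homotopy calculus in a path category. -/

section HomotopyTheory

variable {C : Type u} [Category.{v} C] [FibWeq C]

section Pre

variable [PrePathCategory C]

theorem weq_id (X : C) : weq (𝟙 X) := (PrePathCategory.iso_acyclic (𝟙 X) inferInstance).2

theorem weq_comp {X Y Z : C} {f : X ⟶ Y} {g : Y ⟶ Z} (hf : weq f) (hg : weq g) :
    weq (f ≫ g) := by
  simpa using (PrePathCategory.two_of_six f (𝟙 Y) g (by simpa) (by simpa)).2.2.2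

theorem weq_of_comp_left {X Y Z : C} {f : X ⟶ Y} {g : Y ⟶ Z} (hf : weq f)
    (hfg : weq (f ≫ g)) : weq g :=
  (PrePathCategory.two_of_six (𝟙 X) f g (by simpa) hfg).2.2.1

theorem weq_of_comp_right {X Y Z : C} {f : X ⟶ Y} {g : Y ⟶ Z} (hg : weq g)
    (hfg : weq (f ≫ g)) : weq f :=
  (PrePathCategory.two_of_six f g (𝟙 Z) hfg (by simpa)).1

theorem weq_section {X Y : C} {i : Y ⟶ X} {p : X ⟶ Y} (h : i ≫ p = 𝟙 Y) (hp : weq p) :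
    weq i :=
  weq_of_comp_right hp (h ▸ weq_id Y)

theorem weq_retraction {X Y : C} {i : Y ⟶ X} {p : X ⟶ Y} (h : i ≫ p = 𝟙 Y) (hi : weq i) :
    weq p :=
  weq_of_comp_left hi (h ▸ weq_id Y)

theorem hasPullback_right {X Y Z : C} (f : X ⟶ Z) {p : Y ⟶ Z} (hp : fib p) :
    HasPullback f p :=
  have := PrePathCategory.hasPullback p f hp
  hasPullback_symmetry p f

/-- `X ⨯ T` is the pullback of `Y ⨯ T` along `f : X ⟶ Y`. -/
theorem isPullback_map_id {X Y : C} (f : X ⟶ Y) (T : C) :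
    IsPullback (prod.map f (𝟙 T)) (prod.fst : X ⨯ T ⟶ X) (prod.fst : Y ⨯ T ⟶ Y) f := by
  refine ⟨⟨by simp⟩, ⟨PullbackCone.IsLimit.mk _
    (fun s => prod.lift s.snd (s.fst ≫ prod.snd)) ?_ ?_ ?_⟩⟩
  · intro s
    ext
    · simpa using s.condition.symm
    · simp
  · intro s; simp
  · intro s m h₁ h₂
    ext
    · simpa using h₂
    · simp [← h₁]

theorem weq_map_id {X Y : C} (T : C) {f : X ⟶ Y} (hf : fib f) (hw : weq f) :
    weq (prod.map f (𝟙 T)) :=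
  (PrePathCategory.acyclic_pullback (isPullback_map_id f T).flip hf hw).2

namespace PathObject

variable {B : C} (P : PathObject B)

theorem r_s : P.r ≫ P.s = 𝟙 B := by simpa using P.fac =≫ prod.fst

theorem r_t : P.r ≫ P.t = 𝟙 B := by simpa using P.fac =≫ prod.snd

theorem fib_s : fib P.s := by
  have := PrePathCategory.fib_comp _ _ P.fib_st (fib_fst _ _)
  simpa using this

theorem weq_s : weq P.s := weq_retraction P.r_s P.weq_r

/-- The path object with source and target exchanged. -/
@[simps]
def swap : PathObject B where
  obj := P.obj
  r := P.r
  s := P.t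
  t := P.s
  fac := by ext <;> simp [P.r_s, P.r_t]
  weq_r := P.weq_r
  fib_st := by
    have h : prod.lift P.t P.s = prod.lift P.s P.t ≫ (prod.braiding B B).hom := by simp
    rw [h]
    exact PrePathCategory.fib_comp _ _ P.fib_st (fib_of_isIso _)

end PathObject

theorem Homotopic.symm {Y X : C} {f g : Y ⟶ X} (h : Homotopic f g) : Homotopic g f := by
  obtain ⟨P, k, h₁, h₂⟩ := h
  exact ⟨P.swap, k, h₂, h₁⟩

theorem Homotopic.precomp {Z Y X : C} {f g : Y ⟶ X} (h : Homotopic f g) (k : Z ⟶ Y) :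
    Homotopic (k ≫ f) (k ≫ g) := by
  obtain ⟨P, l, h₁, h₂⟩ := h
  exact ⟨P, k ≫ l, by simp [h₁], by simp [h₂]⟩

end Pre

variable [PathCategory C]

theorem Homotopic.refl {Y X : C} (f : Y ⟶ X) : Homotopic f f := by
  obtain ⟨P⟩ := PathCategory.hasPathObject X
  exact ⟨P, f ≫ P.r, by simp [P.r_s], by simp [P.r_t]⟩

/-- Every map is a weak equivalence followed by a fibration. -/
theorem exists_factorisation {X Y : C} (f : X ⟶ Y) :
    ∃ (M : C) (i : X ⟶ M) (q : M ⟶ Y), weq i ∧ fib q ∧ i ≫ q = f := by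
  obtain ⟨P⟩ := PathCategory.hasPathObject Y
  have := hasPullback_right f P.fib_s
  have hp : IsPullback (pullback.snd f P.s) (pullback.fst f P.s) P.s f :=
    (IsPullback.of_hasPullback f P.s).flip
  have ha := PrePathCategory.acyclic_pullback hp P.fib_s P.weq_s
  have hi : pullback.lift (𝟙 X) (f ≫ P.r) (by simp [P.r_s]) ≫ pullback.fst f P.s = 𝟙 X := by
    simp
  refine ⟨pullback f P.s, pullback.lift (𝟙 X) (f ≫ P.r) (by simp [P.r_s]),
    pullback.snd f P.s ≫ P.t, weq_section hi ha.2, ?_, by simp [P.r_t]⟩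
  -- The mapping path space is the pullback of `(s, t)` along `f × 1`, so its map to `X ⨯ Y` is a
  -- fibration.
  have hq : IsPullback (pullback.snd f P.s)
      (prod.lift (pullback.fst f P.s) (pullback.snd f P.s ≫ P.t))
      (prod.lift P.s P.t) (prod.map f (𝟙 Y)) := by
    refine ⟨⟨by ext <;> simp [pullback.condition]⟩, ⟨PullbackCone.IsLimit.mk _
      (fun s => pullback.lift (s.snd ≫ prod.fst) s.fst
        (by simpa using (s.condition =≫ prod.fst).symm)) ?_ ?_ ?_⟩⟩
    · intro s; simp
    · intro s
      ext
      · simp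
      · simpa using s.condition =≫ prod.snd
    · intro s m h₁ h₂
      apply pullback.hom_ext
      · simp [← h₂]
      · simpa using h₁
  have := PrePathCategory.fib_comp _ _ (PrePathCategory.fib_pullback hq P.fib_st) (fib_snd X Y)
  simpa using this

/-- A commutative square from a weak equivalence `w` to a fibration `p` factors through an
acyclic fibration. -/
theorem exists_acyclic_of_square {A B X Y : C} {w : A ⟶ B} {p : X ⟶ Y} (hw : weq w)
    (hp : fib p) {f : A ⟶ X} {g : B ⟶ Y} (h : f ≫ p = w ≫ g) :
    ∃ (M : C) (i : A ⟶ M) (k : M ⟶ X) (a : M ⟶ B),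
      fib a ∧ weq a ∧ i ≫ k = f ∧ i ≫ a = w ∧ k ≫ p = a ≫ g := by
  have := PrePathCategory.hasPullback p g hp
  have hs := PrePathCategory.fib_pullback (IsPullback.of_hasPullback p g) hp
  -- Factor the induced map from `A` to the pullback of `p` along `g`. Then `M ⟶ B` is a composite
  -- of fibrations, and 2-out-of-3 makes it acyclic because `w` is a weak equivalence.
  obtain ⟨M, i, q, hi, hq, e⟩ := exists_factorisation (pullback.lift f w h)
  have e₂ : i ≫ q ≫ pullback.snd p g = w := by simp [reassoc_of% e]
  refine ⟨M, i, q ≫ pullback.fst p g, q ≫ pullback.snd p g,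
    PrePathCategory.fib_comp _ _ hq hs, ?_, by simp [reassoc_of% e], e₂, ?_⟩
  · exact weq_of_comp_left hi (e₂ ▸ hw)
  · simp [pullback.condition]

/-- A section of the acyclic fibration gives the lift. It need not be compatible with the maps from
`A`, so only the lower triangle commutes. -/
theorem exists_lift {A B X Y : C} {w : A ⟶ B} {p : X ⟶ Y} (hw : weq w)
    (hp : fib p) {f : A ⟶ X} {g : B ⟶ Y} (h : f ≫ p = w ≫ g) : ∃ l : B ⟶ X, l ≫ p = g := by
  obtain ⟨M, i, k, a, ha, ha', -, -, e⟩ := exists_acyclic_of_square hw hp h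
  obtain ⟨s, hs⟩ := PrePathCategory.acyclic_section a ha ha'
  exact ⟨s ≫ k, by simp [e, reassoc_of% hs]⟩

/-- Lift `(f, g)` along the fibration `(s, t)`, starting from constant paths on `A`. This is the
main source of homotopies below: it is enough to compare two maps on constant paths. -/
theorem Homotopic.of_weq_comp_eq {A B X : C} {w : A ⟶ B} (hw : weq w) {f g : B ⟶ X}
    (h : w ≫ f = w ≫ g) : Homotopic f g := by
  obtain ⟨P⟩ := PathCategory.hasPathObject X
  obtain ⟨l, hl⟩ := exists_lift (f := w ≫ f ≫ P.r) (g := prod.lift f g) hw P.fib_st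
    (by ext <;> simp [P.r_s, P.r_t, h])
  exact ⟨P, l, by simpa using hl =≫ prod.fst, by simpa using hl =≫ prod.snd⟩

theorem Homotopic.postcomp {Y X Z : C} {f g : Y ⟶ X} (h : Homotopic f g) (k : X ⟶ Z) :
    Homotopic (f ≫ k) (g ≫ k) := by
  obtain ⟨P, l, rfl, rfl⟩ := h
  have : Homotopic (P.s ≫ k) (P.t ≫ k) :=
    .of_weq_comp_eq P.weq_r (by rw [reassoc_of% P.r_s, reassoc_of% P.r_t])
  simpa using this.precomp l

theorem Homotopic.trans {Y X : C} {f g h : Y ⟶ X} (h₁ : Homotopic f g) (h₂ : Homotopic g h) :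
    Homotopic f h := by
  obtain ⟨P, k, rfl, rfl⟩ := h₁
  obtain ⟨P', k', e, rfl⟩ := h₂
  have := hasPullback_right P.t P'.fib_s
  have hp := PrePathCategory.acyclic_pullback (IsPullback.of_hasPullback P.t P'.s).flip
    P'.fib_s P'.weq_s
  let i : P.obj ⟶ pullback P.t P'.s := pullback.lift (𝟙 _) (P.t ≫ P'.r) (by simp [P'.r_s])
  have hi : weq i := weq_section (by simp [i]) hp.2
  have : Homotopic (pullback.fst P.t P'.s ≫ P.s) (pullback.snd P.t P'.s ≫ P'.t) :=
    .of_weq_comp_eq (weq_comp P.weq_r hi) (by simp [i, P'.r_t, P.r_s, P.r_t])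
  simpa using this.precomp (pullback.lift k k' e.symm)

theorem Homotopic.of_eq {Y X : C} {f g : Y ⟶ X} (h : f = g) : Homotopic f g := h ▸ .refl f

/-- The section of the acyclic fibration is also its homotopy inverse, which gives the upper
triangle up to homotopy. -/
theorem exists_lift_homotopic {A B X Y : C} {w : A ⟶ B} {p : X ⟶ Y} (hw : weq w)
    (hp : fib p) {f : A ⟶ X} {g : B ⟶ Y} (h : f ≫ p = w ≫ g) :
    ∃ l : B ⟶ X, l ≫ p = g ∧ Homotopic (w ≫ l) f := by
  obtain ⟨M, i, k, a, ha, ha', rfl, rfl, e⟩ := exists_acyclic_of_square hw hp h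
  obtain ⟨s, hs⟩ := PrePathCategory.acyclic_section a ha ha'
  have : Homotopic (a ≫ s) (𝟙 M) :=
    .of_weq_comp_eq (weq_section hs ha') (by simp [reassoc_of% hs])
  exact ⟨s ≫ k, by simp [e, reassoc_of% hs], by simpa using (this.postcomp k).precomp i⟩

/-- Homotopy lifting along a fibration. -/
theorem Homotopic.exists_lift {T X Y : C} {p : X ⟶ Y} (hp : fib p) {m : T ⟶ X} {f : T ⟶ Y}
    (h : Homotopic (m ≫ p) f) : ∃ m' : T ⟶ X, m' ≫ p = f ∧ Homotopic m' m := by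
  obtain ⟨P, k, e, rfl⟩ := h
  have := hasPullback_right p P.fib_s
  have ha := PrePathCategory.acyclic_pullback (IsPullback.of_hasPullback p P.s).flip
    P.fib_s P.weq_s
  let i : X ⟶ pullback p P.s := pullback.lift (𝟙 _) (p ≫ P.r) (by simp [P.r_s])
  have hi : i ≫ pullback.fst p P.s = 𝟙 _ := by simp [i]
  have hw : weq i := weq_section hi ha.2
  -- `g` is transport: from a point of `X` and a path starting at its image, it yields a point over
  -- the end of the path. It fixes points up to homotopy along constant paths.
  obtain ⟨g, hg, hg'⟩ := exists_lift_homotopic (f := 𝟙 X) (g := pullback.snd p P.s ≫ P.t) hw hp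
    (by simp [i, P.r_t])
  have h₁ : Homotopic (pullback.fst p P.s ≫ i) (𝟙 _) :=
    .of_weq_comp_eq hw (by simp [reassoc_of% hi])
  have h₂ : Homotopic g (pullback.fst p P.s) := by
    have a := h₁.symm.postcomp g
    have b := hg'.precomp (pullback.fst p P.s)
    simp only [Category.assoc, Category.id_comp, Category.comp_id] at a b
    exact a.trans b
  exact ⟨pullback.lift m k e.symm ≫ g, by simp [hg], by
    simpa using h₂.precomp (pullback.lift m k e.symm)⟩

theorem FibrewiseHomotopic.homotopic {Y X I : C} {p : X ⟶ I} {f g : Y ⟶ X}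
    (h : FibrewiseHomotopic p f g) : Homotopic f g := by
  obtain ⟨P, k, rfl, rfl⟩ := h
  have : Homotopic (P.st ≫ P.fst) (P.st ≫ P.snd) :=
    .of_weq_comp_eq P.weq_r (by rw [P.fac_fst, P.fac_snd])
  exact this.precomp k

theorem Homotopic.prod_lift {T X Y : C} {f f' : T ⟶ X} {g g' : T ⟶ Y} (hf : Homotopic f f')
    (hg : Homotopic g g') : Homotopic (prod.lift f g) (prod.lift f' g') := by
  have key : ∀ {X Y : C} {f f' : T ⟶ X} (g : T ⟶ Y), Homotopic f f' →
      Homotopic (prod.lift f g) (prod.lift f' g) := by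
    rintro X Y _ _ g ⟨P, k, rfl, rfl⟩
    -- One coordinate is moved at a time, and `P.obj ⨯ Y` carries the generic such homotopy.
    have hr : weq (prod.map P.r (𝟙 Y)) :=
      weq_section (p := prod.map P.s (𝟙 Y)) (by simp [P.r_s]) (weq_map_id Y P.fib_s P.weq_s)
    have : Homotopic (prod.map P.s (𝟙 Y)) (prod.map P.t (𝟙 Y)) :=
      .of_weq_comp_eq hr (by simp [P.r_s, P.r_t])
    simpa using this.precomp (prod.lift k g)
  refine (key g hf).trans ?_
  simpa using (key f' hg).postcomp (prod.braiding _ _).hom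

end HomotopyTheory

/-! ### Existence of the choices. -/

section Existence

variable {C : Type u} [Category.{v} C] [FibWeq C] [PathCategory C]

/-- The weak exponential is the weak `Π`-type of `X ⨯ Y ⟶ Y` along `Y ⟶ 1`. -/
theorem exists_isWeakHomotopyExponential (hPi : HasWeakHomotopyPi C) (X Y : C) :
    ∃ (E : C) (ev : E ⨯ Y ⟶ X), IsWeakHomotopyExponential ev := by
  have : HasTerminal C := PrePathCategory.hasTerminal
  have hprod : ∀ A : C, IsPullback (prod.snd : A ⨯ Y ⟶ Y) (prod.fst : A ⨯ Y ⟶ A)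
      (terminal.from Y) (terminal.from A) := fun A =>
    (IsPullback.of_isLimit_binaryFan_of_isTerminal (prodIsProd A Y) terminalIsTerminal).flip
  obtain ⟨P, π, αP, a, b, ev, -, hP, -, hev⟩ := hPi (prod.snd : X ⨯ Y ⟶ Y) (terminal.from Y)
    (fib_snd X Y) (PrePathCategory.fib_terminal _ terminalIsTerminal)
  refine ⟨P, hP.lift prod.snd prod.fst (Subsingleton.elim _ _) ≫ ev ≫ prod.fst, ?_⟩
  intro A h
  obtain ⟨n, k, -, hka, hkb, hm⟩ := hev A (terminal.from A) (A ⨯ Y) prod.snd prod.fst (hprod A)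
    (prod.lift h prod.snd) (by simp)
  have hk : k = prod.map n (𝟙 Y) ≫ hP.lift prod.snd prod.fst (Subsingleton.elim _ _) :=
    hP.hom_ext (by simp [hka]) (by simp [hkb])
  refine ⟨n, ?_⟩
  simpa [hk] using hm.homotopic.symm.postcomp prod.fst

/-- Over a given weak homotopy exponential of the base of a fibration there is a fibration of
exponentials. -/
theorem exists_isFibrationOfExponentials (hPi : HasWeakHomotopyPi C) {X Y Z YX : C} {p : Z ⟶ Y}
    (hp : fib p) {evY : YX ⨯ X ⟶ Y} (hY : IsWeakHomotopyExponential evY) :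
    ∃ (ZX : C) (evZ : ZX ⨯ X ⟶ Z) (pX : ZX ⟶ YX), IsFibrationOfExponentials p evY evZ pX := by
  have := PrePathCategory.hasPullback p evY hp
  -- A point of `Z ^ X` over `u` in `Y ^ X` is a section of `p` over the graph of `u`: pull `p` back
  -- along `evY` and take `Π` along the projection to `YX`.
  obtain ⟨P, π, αP, a, b, ev, hπ, hP, hev, H⟩ := hPi (pullback.snd p evY)
    (prod.fst : YX ⨯ X ⟶ YX)
    (PrePathCategory.fib_pullback (IsPullback.of_hasPullback p evY) hp) (fib_fst _ _)
  let e : P ⨯ X ⟶ αP := hP.lift (prod.map π (𝟙 X)) prod.fst (by simp)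
  have comm : prod.map π (𝟙 X) ≫ evY = (e ≫ ev ≫ pullback.fst p evY) ≫ p := by
    simp [pullback.condition, reassoc_of% hev, e]
  have surj : ∀ (T : C) (f : T ⟶ YX) (m : T ⨯ X ⟶ Z),
      Homotopic (prod.map f (𝟙 X) ≫ evY) (m ≫ p) →
        ∃ n : T ⟶ P, Homotopic (n ≫ π) f ∧
          Homotopic (prod.map n (𝟙 X) ≫ e ≫ ev ≫ pullback.fst p evY) m := by
    intro T f m hm
    -- Homotopy lifting replaces `m` by a map strictly over the transpose of `f`, as the `Π`-type
    -- requires.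
    obtain ⟨m', e', hm'⟩ := hm.symm.exists_lift hp
    obtain ⟨n, k, hn, hka, hkb, hk⟩ := H T f (T ⨯ X) (prod.map f (𝟙 X)) prod.fst
      (isPullback_map_id f X) (pullback.lift m' _ e') (by simp)
    have hk' : k = prod.map n (𝟙 X) ≫ e :=
      hP.hom_ext (by simp [hka, e, hn]) (by simp [hkb, e])
    refine ⟨n, .of_eq hn, ?_⟩
    have := hk.homotopic.symm.postcomp (pullback.fst p evY)
    simp only [hk', Category.assoc, pullback.lift_fst] at this
    exact this.trans hm'
  refine ⟨P, e ≫ ev ≫ pullback.fst p evY, π, hY, ?_, hπ, comm, surj⟩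
  intro A h
  obtain ⟨f, hf⟩ := hY A (h ≫ p)
  obtain ⟨n, -, hn⟩ := surj A f h hf
  exact ⟨n, hn⟩

theorem IsWeakHomotopyExponential.prod {X Y E : C} {ev : E ⨯ Y ⟶ X}
    (h : IsWeakHomotopyExponential ev) :
    IsWeakHomotopyExponential (X := X ⨯ X)
      (prod.lift (prod.map prod.fst (𝟙 Y) ≫ ev) (prod.map (prod.snd : E ⨯ E ⟶ E) (𝟙 Y) ≫ ev)) := by
  intro A k
  obtain ⟨H, hH⟩ := h A (k ≫ prod.fst)
  obtain ⟨K, hK⟩ := h A (k ≫ prod.snd)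
  refine ⟨prod.lift H K, ?_⟩
  have e : k = prod.lift (k ≫ prod.fst) (k ≫ prod.snd) := by ext <;> simp
  rw [e]
  refine .trans (.of_eq ?_) (hH.prod_lift hK)
  ext <;> simp

theorem nonempty_expData (hPi : HasWeakHomotopyPi C) (A B : Ex C) : Nonempty (ExpData A B) := by
  obtain ⟨E, ev, hE⟩ := exists_isWeakHomotopyExponential hPi A.X B.X
  obtain ⟨D, evD, hD⟩ := exists_isWeakHomotopyExponential hPi (A.X ⨯ A.X) B.R
  obtain ⟨RS, evRS, k, hk⟩ := exists_isFibrationOfExponentials hPi A.isRel.fib_lift hD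
  obtain ⟨d, hd⟩ := hD E
    (prod.lift (prod.map (𝟙 E) B.p₁ ≫ ev) (prod.map (𝟙 E) B.p₂ ≫ ev))
  obtain ⟨RY, evRY, l, hl⟩ := exists_isFibrationOfExponentials hPi A.isRel.fib_lift hE.prod
  have := hasPullback_right d hk.fib_pX
  have := hasPullback_right (prod.map (pullback.fst d k) (pullback.fst d k)) hl.fib_pX
  let j := pullback.fst (prod.map (pullback.fst d k) (pullback.fst d k)) l
  have hj : prod.lift (j ≫ prod.fst) (j ≫ prod.snd) = j := by ext <;> simp
  exact ⟨{
    E := E, ev := ev, weak := hE, D := D, evD := evD, RS := RS, evRS := evRS, k := k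
    isFibS := hk, d := d, d_comm := hd
    W := pullback d k, p := pullback.fst d k, w := pullback.snd d k
    isPullbackW := IsPullback.of_hasPullback d k
    RY := RY, evRY := evRY, l := l, isFibY := hl
    Q := _, q₁ := j ≫ prod.fst, q₂ := j ≫ prod.snd, qR := pullback.snd _ _
    isPullbackQ := by rw [hj]; exact IsPullback.of_hasPullback _ l }⟩

end Existence

/-! ### Relations through generalised elements. -/

theorem IsHomotopyEquivRel.of_iff {C : Type u} [Category.{v} C] [FibWeq C]
    [HasBinaryProducts C] {X R : C} {p₁ p₂ : R ⟶ X} (hp : fib (prod.lift p₁ p₂))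
    (r : ∀ {T : C}, (T ⟶ X) → (T ⟶ X) → Prop) (hr : ∀ T : C, Equivalence (r (T := T)))
    (h : ∀ {T : C} (x x' : T ⟶ X), (∃ y : T ⟶ R, y ≫ p₁ = x ∧ y ≫ p₂ = x') ↔ r x x') :
    IsHomotopyEquivRel p₁ p₂ where
  fib_lift := hp
  refl := by
    -- Each axiom is the property of `r` at a generic element: the identity of `X`, the identity of
    -- `R`, and the two projections of the pullback of composable pairs.
    obtain ⟨y, h₁, h₂⟩ := (h (𝟙 X) (𝟙 X)).2 ((hr X).refl _)
    exact ⟨y, by ext <;> simp [h₁, h₂]⟩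
  symm := (h _ _).2 ((hr R).symm ((h _ _).1 ⟨𝟙 R, Category.id_comp _, Category.id_comp _⟩))
  trans q₁ q₂ hq := (h _ _).2
    ((hr _).trans ((h _ _).1 ⟨q₁, rfl, rfl⟩) ((h _ _).1 ⟨q₂, hq.w.symm, rfl⟩))

namespace Ex

section Rel

variable {C : Type u} [Category.{v} C] [FibWeq C] [PrePathCategory C] {A B : Ex C}

/-- Two maps into the carrier of `A` are related if their pairing factors through the
relation. -/
def Rel (A : Ex C) {T : C} (f g : T ⟶ A.X) : Prop :=
  ∃ H : T ⟶ A.R, H ≫ A.p₁ = f ∧ H ≫ A.p₂ = g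

namespace Rel

variable {T : C} {f g h : T ⟶ A.X}

theorem of_lift {H : T ⟶ A.R} (e : H ≫ A.rel = prod.lift f g) : A.Rel f g :=
  ⟨H, by simpa using e =≫ prod.fst, by simpa using e =≫ prod.snd⟩

theorem exists_lift (H : A.Rel f g) : ∃ K : T ⟶ A.R, K ≫ A.rel = prod.lift f g := by
  obtain ⟨K, rfl, rfl⟩ := H
  exact ⟨K, by ext <;> simp⟩

theorem refl (f : T ⟶ A.X) : A.Rel f f := by
  obtain ⟨ρ, hρ⟩ := A.isRel.refl
  exact of_lift (H := f ≫ ρ) (by rw [Category.assoc, hρ]; simp)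

theorem symm (H : A.Rel f g) : A.Rel g f := by
  obtain ⟨K, rfl, rfl⟩ := H
  obtain ⟨σ, h₁, h₂⟩ := A.isRel.symm
  exact ⟨K ≫ σ, by simp [h₁], by simp [h₂]⟩

theorem trans (H : A.Rel f g) (H' : A.Rel g h) : A.Rel f h := by
  obtain ⟨K, rfl, rfl⟩ := H
  obtain ⟨K', e, rfl⟩ := H'
  have := A.hasPullback_p₂_p₁
  obtain ⟨τ, e₁, e₂⟩ := A.isRel.trans _ _ (IsPullback.of_hasPullback A.p₂ A.p₁)
  exact ⟨pullback.lift K K' e.symm ≫ τ, by simp [e₁], by simp [e₂]⟩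

theorem precomp (H : A.Rel f g) {S : C} (k : S ⟶ T) : A.Rel (k ≫ f) (k ≫ g) := by
  obtain ⟨K, rfl, rfl⟩ := H
  exact ⟨k ≫ K, by simp, by simp⟩

theorem map (H : A.Rel f g) (k : A ⟶ B) : B.Rel (f ≫ k.hom) (g ≫ k.hom) := by
  obtain ⟨K, rfl, rfl⟩ := H
  obtain ⟨φ, e₁, e₂⟩ := (tracked_iff _).1 k.tracked
  exact ⟨K ≫ φ, by simp [e₁], by simp [e₂]⟩

end Rel

theorem rel_p₁_p₂ (A : Ex C) : A.Rel A.p₁ A.p₂ := ⟨𝟙 _, by simp, by simp⟩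

/-- A map of carriers which preserves the relation is a morphism. -/
def homOfRel (f : A.X ⟶ B.X) (h : B.Rel (A.p₁ ≫ f) (A.p₂ ≫ f)) : A ⟶ B :=
  ⟨f, (tracked_iff f).2 h⟩

end Rel

variable {C : Type u} [Category.{v} C] [FibWeq C] [PathCategory C] {A : Ex C}

/-- Reflexivity lifts along `P.r` to a map from the path object to the relation, because `A.rel` is
a fibration. -/
theorem Rel.of_homotopic {T : C} {f g : T ⟶ A.X} (h : Homotopic f g) : A.Rel f g := by
  obtain ⟨P, k, rfl, rfl⟩ := h
  obtain ⟨ρ, hρ⟩ := A.isRel.refl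
  obtain ⟨l, hl⟩ := PathCat.exists_lift (f := ρ) (g := prod.lift P.s P.t) P.weq_r A.isRel.fib_lift
    (by rw [hρ, P.fac])
  exact (of_lift hl).precomp k

theorem Rel.of_homotopic_lift {T : C} {f g : T ⟶ A.X} {m : T ⟶ A.R}
    (h : Homotopic (m ≫ A.rel) (prod.lift f g)) : A.Rel f g := by
  obtain ⟨m', e, -⟩ := h.exists_lift A.isRel.fib_lift
  exact of_lift e

end Ex

/-! ### What maps into `W` and `Q` classify, and evaluation. -/

namespace ExpData

variable {C : Type u} [Category.{v} C] [FibWeq C] [PathCategory C] {A B : Ex C}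
  (c : ExpData A B)

theorem exists_lift_l_iff {T : C} (e e' : T ⟶ c.E) :
    (∃ x : T ⟶ c.RY, x ≫ c.l = prod.lift e e') ↔
      A.Rel (prod.map e (𝟙 B.X) ≫ c.ev) (prod.map e' (𝟙 B.X) ≫ c.ev) := by
  have he : prod.map (prod.lift e e') (𝟙 B.X) ≫
      prod.lift (prod.map prod.fst (𝟙 B.X) ≫ c.ev) (prod.map prod.snd (𝟙 B.X) ≫ c.ev) =
      prod.lift (prod.map e (𝟙 B.X) ≫ c.ev) (prod.map e' (𝟙 B.X) ≫ c.ev) := by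
    ext <;> simp
  constructor
  · rintro ⟨x, hx⟩
    refine Ex.Rel.of_lift (H := prod.map x (𝟙 B.X) ≫ c.evRY) ?_
    rw [Category.assoc, ← c.isFibY.comm, ← prod.map_comp_id_assoc, hx, he]
  · intro h
    obtain ⟨m, hm⟩ := h.exists_lift
    -- Goodness gives a lift only up to homotopy; since `c.l` is a fibration, it can be made strict.
    obtain ⟨n, hn, -⟩ := c.isFibY.surj T (prod.lift e e') m (.of_eq (by rw [he, hm]))
    obtain ⟨x, hx, -⟩ := hn.exists_lift c.isFibY.fib_pX
    exact ⟨x, hx⟩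

theorem exists_lift_k_iff {T : C} (e : T ⟶ c.E) :
    (∃ x : T ⟶ c.RS, x ≫ c.k = e ≫ c.d) ↔
      A.Rel (prod.map e B.p₁ ≫ c.ev) (prod.map e B.p₂ ≫ c.ev) := by
  have he : Homotopic (prod.map (e ≫ c.d) (𝟙 B.R) ≫ c.evD)
      (prod.lift (prod.map e B.p₁ ≫ c.ev) (prod.map e B.p₂ ≫ c.ev)) := by
    have := c.d_comm.precomp (prod.map e (𝟙 B.R))
    rw [← prod.map_comp_id_assoc] at this
    refine this.trans (.of_eq ?_)
    ext <;> simp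
  constructor
  · rintro ⟨x, hx⟩
    refine Ex.Rel.of_homotopic_lift (m := prod.map x (𝟙 B.R) ≫ c.evRS) ?_
    rw [Category.assoc, ← c.isFibS.comm, ← prod.map_comp_id_assoc, hx]
    exact he
  · intro h
    obtain ⟨m, hm⟩ := h.exists_lift
    obtain ⟨n, hn, -⟩ := c.isFibS.surj T (e ≫ c.d) m (by rw [hm]; exact he)
    obtain ⟨x, hx, -⟩ := hn.exists_lift c.isFibS.fib_pX
    exact ⟨x, hx⟩

theorem exists_lift_q_iff {T : C} (w w' : T ⟶ c.W) :
    (∃ x : T ⟶ c.Q, x ≫ c.q₁ = w ∧ x ≫ c.q₂ = w') ↔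
      A.Rel (prod.map (w ≫ c.p) (𝟙 B.X) ≫ c.ev) (prod.map (w' ≫ c.p) (𝟙 B.X) ≫ c.ev) := by
  rw [← exists_lift_l_iff]
  constructor
  · rintro ⟨x, rfl, rfl⟩
    exact ⟨x ≫ c.qR, by rw [Category.assoc, ← c.isPullbackQ.w]; ext <;> simp⟩
  · rintro ⟨x, hx⟩
    have hw : prod.lift w w' ≫ prod.map c.p c.p = x ≫ c.l := by simp [hx]
    have := c.isPullbackQ.lift_fst _ _ hw
    exact ⟨c.isPullbackQ.lift _ _ hw, by simpa using this =≫ prod.fst,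
      by simpa using this =≫ prod.snd⟩

theorem isHomotopyEquivRel : IsHomotopyEquivRel c.q₁ c.q₂ :=
  .of_iff (PrePathCategory.fib_pullback c.isPullbackQ.flip c.isFibY.fib_pX) _
    (fun _ => ⟨fun _ => .refl _, .symm, .trans⟩) c.exists_lift_q_iff

/-- The exponential `(W, Q)`. -/
abbrev exp : Ex C := c.obj c.isHomotopyEquivRel

/-- The projection `W ⟶ X ^ Y`. -/
def expProj : c.exp.X ⟶ c.E := c.p

theorem rel_exp_iff {T : C} (w w' : T ⟶ c.exp.X) : c.exp.Rel w w' ↔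
    A.Rel (prod.map (w ≫ c.expProj) (𝟙 B.X) ≫ c.ev) (prod.map (w' ≫ c.expProj) (𝟙 B.X) ≫ c.ev) :=
  c.exists_lift_q_iff w w'

/-- Change the argument first, with `w` fixed, since elements of `W` preserve relations; then change
`w` at the argument `y'`, by the meaning of `Q`. -/
theorem rel_ev {T : C} {w w' : T ⟶ c.exp.X} {y y' : T ⟶ B.X} (hw : c.exp.Rel w w')
    (hy : B.Rel y y') :
    A.Rel (prod.lift (w ≫ c.expProj) y ≫ c.ev) (prod.lift (w' ≫ c.expProj) y' ≫ c.ev) := by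
  have h₁ := ((c.rel_exp_iff _ _).1 hw).precomp (prod.lift (𝟙 T) y')
  have h₂ := (c.exists_lift_k_iff c.expProj).1 ⟨c.w, c.isPullbackW.w.symm⟩
  obtain ⟨s, rfl, rfl⟩ := hy
  have h₃ := h₂.precomp (prod.lift w s)
  simp only [prod.lift_map_assoc, Category.id_comp, Category.comp_id] at h₁ h₃
  exact h₃.trans h₁

/-- Evaluation `A ^ B ⨯ B ⟶ A`. -/
noncomputable def eval : c.exp ⨯ B ⟶ A :=
  Ex.homOfRel (prod.lift ((prod.fst : c.exp ⨯ B ⟶ c.exp).hom ≫ c.expProj)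
    (prod.snd : c.exp ⨯ B ⟶ B).hom ≫ c.ev) (by
      have := c.rel_ev ((c.exp ⨯ B).rel_p₁_p₂.map prod.fst) ((c.exp ⨯ B).rel_p₁_p₂.map prod.snd)
      simpa [prod.comp_lift_assoc] using this)

theorem lift_eval {T : Ex C} (f : T ⟶ c.exp) (g : T ⟶ B) :
    (prod.lift f g ≫ c.eval).hom = prod.lift (f.hom ≫ c.expProj) g.hom ≫ c.ev := by
  have h₁ := congrArg Ex.Hom.hom (prod.lift_fst f g)
  have h₂ := congrArg Ex.Hom.hom (prod.lift_snd f g)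
  rw [Ex.comp_hom] at h₁ h₂
  simp [eval, Ex.homOfRel, prod.comp_lift_assoc, reassoc_of% h₁, h₂]

end ExpData

/-! ### Products, path objects and homotopy in `Ex C`. -/

namespace Ex

variable {C : Type u} [Category.{v} C] [FibWeq C] [PrePathCategory C]

theorem homRel_iff_rel {A B : Ex C} (f g : A ⟶ B) : homRel C f g ↔ B.Rel f.hom g.hom :=
  homRel_iff f g

section Products

variable {A B : Ex C}

/-- The comparison of the product in `C` with the chosen product in `Ex C`. -/
noncomputable def toProd (A B : Ex C) : prodObj A B ⟶ A ⨯ B :=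
  prod.lift (prodFst A B) (prodSnd A B)

/-- The carrier of a product in `Ex C` is the product of the carriers. -/
noncomputable def prodIso (A B : Ex C) : A.X ⨯ B.X ≅ (A ⨯ B).X where
  hom := (toProd A B).hom
  inv := prod.lift (prod.fst : A ⨯ B ⟶ A).hom (prod.snd : A ⨯ B ⟶ B).hom
  hom_inv_id := by
    have : toProd A B ≫ prodLift prod.fst prod.snd = 𝟙 _ := by
      apply prod_hom_ext <;> simp [toProd, prodLift_fst, prodLift_snd]
    exact congrArg Hom.hom this
  inv_hom_id := by
    have : prodLift prod.fst prod.snd ≫ toProd A B = 𝟙 (A ⨯ B) := by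
      apply prod.hom_ext <;> simp [toProd, prodLift_fst, prodLift_snd]
    exact congrArg Hom.hom this

theorem prodIso_inv : (prodIso A B).inv =
    prod.lift (prod.fst : A ⨯ B ⟶ A).hom (prod.snd : A ⨯ B ⟶ B).hom := rfl

@[simp]
theorem prodIso_hom_fst : (prodIso A B).hom ≫ (prod.fst : A ⨯ B ⟶ A).hom = prod.fst :=
  congrArg Hom.hom (prod.lift_fst (prodFst A B) (prodSnd A B))

@[simp]
theorem prodIso_hom_fst_assoc {D : C} (h : A.X ⟶ D) :
    (prodIso A B).hom ≫ (prod.fst : A ⨯ B ⟶ A).hom ≫ h = prod.fst ≫ h := by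
  rw [← Category.assoc, prodIso_hom_fst]

@[simp]
theorem prodIso_hom_snd : (prodIso A B).hom ≫ (prod.snd : A ⨯ B ⟶ B).hom = prod.snd :=
  congrArg Hom.hom (prod.lift_snd (prodFst A B) (prodSnd A B))

@[simp]
theorem prodIso_hom_snd_assoc {D : C} (h : B.X ⟶ D) :
    (prodIso A B).hom ≫ (prod.snd : A ⨯ B ⟶ B).hom ≫ h = prod.snd ≫ h := by
  rw [← Category.assoc, prodIso_hom_snd]

theorem prod_carrier_ext {T : C} {f g : T ⟶ (A ⨯ B).X}
    (h₁ : f ≫ (prod.fst : A ⨯ B ⟶ A).hom = g ≫ (prod.fst : A ⨯ B ⟶ A).hom)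
    (h₂ : f ≫ (prod.snd : A ⨯ B ⟶ B).hom = g ≫ (prod.snd : A ⨯ B ⟶ B).hom) : f = g := by
  rw [← cancel_mono (prodIso A B).inv, prodIso_inv, prod.comp_lift, prod.comp_lift, h₁, h₂]

theorem lift_hom {D : Ex C} (f : D ⟶ A) (g : D ⟶ B) :
    (prod.lift f g).hom = prod.lift f.hom g.hom ≫ (prodIso A B).hom := by
  apply prod_carrier_ext
  · rw [Category.assoc, prodIso_hom_fst, prod.lift_fst]
    exact congrArg Hom.hom (prod.lift_fst f g)
  · rw [Category.assoc, prodIso_hom_snd, prod.lift_snd]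
    exact congrArg Hom.hom (prod.lift_snd f g)

theorem prod_rel {T : C} {a a' : T ⟶ A.X} {b b' : T ⟶ B.X} (ha : A.Rel a a')
    (hb : B.Rel b b') : (A ⨯ B).Rel (prod.lift a b ≫ (prodIso A B).hom)
      (prod.lift a' b' ≫ (prodIso A B).hom) := by
  obtain ⟨K, rfl, rfl⟩ := ha
  obtain ⟨L, rfl, rfl⟩ := hb
  have : (prodObj A B).Rel (prod.lift (K ≫ A.p₁) (L ≫ B.p₁))
      (prod.lift (K ≫ A.p₂) (L ≫ B.p₂)) :=
    ⟨prod.lift K L, by simp [prodObj], by simp [prodObj]⟩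
  exact this.map (toProd A B)

end Products

/-- The connection `∇` is this lifting property applied to the generic pair, the projections of the
pullback. -/
theorem fib_of_exists_lift {A B : Ex C} {f : A ⟶ B} (hf : fib f.hom)
    (h : ∀ {T : C} (a : T ⟶ A.X) (b : T ⟶ B.X), B.Rel (a ≫ f.hom) b →
      ∃ a' : T ⟶ A.X, A.Rel a a' ∧ a' ≫ f.hom = b) : fib f := by
  have := PrePathCategory.hasPullback f.hom B.p₁ hf
  obtain ⟨_, ⟨K, h₁, rfl⟩, e⟩ := h (pullback.fst f.hom B.p₁) (pullback.snd f.hom B.p₁ ≫ B.p₂)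
    ⟨pullback.snd _ _, pullback.condition.symm, rfl⟩
  exact ⟨hf, _, _, _, IsPullback.of_hasPullback f.hom B.p₁, K, h₁, by simpa using e⟩

/-- The homotopy equivalence relation on `Z` induced by a map `f : Z ⟶ A.X`. -/
theorem exists_comap {Z : C} (A : Ex C) (f : Z ⟶ A.X) :
    ∃ (R : C) (p₁ p₂ : R ⟶ Z), IsHomotopyEquivRel p₁ p₂ ∧ ∀ {T : C} (z z' : T ⟶ Z),
      (∃ x : T ⟶ R, x ≫ p₁ = z ∧ x ≫ p₂ = z') ↔ A.Rel (z ≫ f) (z' ≫ f) := by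
  have := hasPullback_right (prod.map f f) A.isRel.fib_lift
  let j := pullback.fst (prod.map f f) A.rel
  have hj : prod.lift (j ≫ prod.fst) (j ≫ prod.snd) = j := by ext <;> simp
  have key : ∀ {T : C} (z z' : T ⟶ Z), (∃ x : T ⟶ pullback (prod.map f f) A.rel,
      x ≫ j ≫ prod.fst = z ∧ x ≫ j ≫ prod.snd = z') ↔ A.Rel (z ≫ f) (z' ≫ f) := by
    intro T z z'
    constructor
    · rintro ⟨x, rfl, rfl⟩
      refine Rel.of_lift (H := x ≫ pullback.snd _ _) ?_
      rw [Category.assoc, ← pullback.condition]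
      ext <;> simp [j]
    · intro h
      obtain ⟨K, hK⟩ := h.exists_lift
      exact ⟨pullback.lift (prod.lift z z') K (by rw [hK]; simp), by simp [j], by simp [j]⟩
  exact ⟨_, j ≫ prod.fst, j ≫ prod.snd, .of_iff (by
    rw [hj]
    exact PrePathCategory.fib_pullback (IsPullback.of_hasPullback _ _).flip A.isRel.fib_lift)
    (fun z z' => A.Rel (z ≫ f) (z' ≫ f)) (fun T => ⟨fun _ => .refl _, .symm, .trans⟩) key, key⟩

/-- The path object of `A`, whose carrier is the relation of `A`. -/
theorem exists_pathObject (A : Ex C) : ∃ P : PathObject A, ∀ {T : Ex C} {f g : T ⟶ A},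
    homRel C f g → ∃ h : T ⟶ P.obj, h ≫ P.s = f ∧ h ≫ P.t = g := by
  -- Elements of `A.R` are declared related when their sources are. Their targets are then related
  -- too, and contracting to the source makes reflexivity invertible up to `∼`.
  obtain ⟨R, p₁, p₂, hR, key⟩ := A.exists_comap A.p₁
  let O : Ex C := ⟨A.R, R, p₁, p₂, hR⟩
  have hO : ∀ {T : C} (z z' : T ⟶ A.R), O.Rel z z' ↔ A.Rel (z ≫ A.p₁) (z' ≫ A.p₁) := key
  have hO' : ∀ {T : C} {z z' : T ⟶ A.R}, O.Rel z z' → A.Rel (z ≫ A.p₂) (z' ≫ A.p₂) :=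
    fun {T z z'} h => ((A.rel_p₁_p₂.precomp z).symm.trans ((hO z z').1 h)).trans
      (A.rel_p₁_p₂.precomp z')
  obtain ⟨ρ, hρ₁, hρ₂⟩ := Rel.refl (𝟙 A.X)
  let s : O ⟶ A := homOfRel (A := O) A.p₁ ((hO _ _).1 O.rel_p₁_p₂)
  let t : O ⟶ A := homOfRel (A := O) A.p₂ (hO' O.rel_p₁_p₂)
  let r : A ⟶ O := homOfRel (B := O) ρ ((hO _ _).2 (by simpa [hρ₁] using A.rel_p₁_p₂))
  have hrs : r ≫ s = 𝟙 A := hom_ext hρ₁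
  have hrt : r ≫ t = 𝟙 A := hom_ext hρ₂
  refine ⟨{
    obj := O, r := r, s := s, t := t
    fac := by apply prod.hom_ext <;> simp [hrs, hrt]
    weq_r := ⟨s, ?_, ?_⟩
    fib_st := ?_ }, ?_⟩
  · refine (homRel_iff_rel _ _).2 ((hO _ _).2 ?_)
    have : (s ≫ r).hom ≫ A.p₁ = A.p₁ := by simp [s, r, homOfRel, hρ₁]
    rw [this]
    simpa [O] using Rel.refl A.p₁
  · rw [hrs]
    exact (homRel_iff_rel _ _).2 (.refl _)
  · refine fib_of_exists_lift ?_ ?_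
    · rw [lift_hom]
      exact PrePathCategory.fib_comp _ _ A.isRel.fib_lift (fib_of_isIso _)
    · intro T a b hab
      have h₁ := hab.map prod.fst
      have h₂ := hab.map prod.snd
      rw [lift_hom] at h₁ h₂
      simp only [Category.assoc, prodIso_hom_fst, prodIso_hom_snd, prod.lift_fst,
        prod.lift_snd] at h₁ h₂
      -- Transport of `a` to new endpoints: go back to the old source, along `a`, then on to the new
      -- target.
      obtain ⟨K, e₁, e₂⟩ := (h₁.symm.trans (A.rel_p₁_p₂.precomp a)).trans h₂
      refine ⟨K, (hO _ _).2 (by rw [e₁]; exact h₁), prod_carrier_ext ?_ ?_⟩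
      · rw [lift_hom]; simpa [s, homOfRel] using e₁
      · rw [lift_hom]; simpa [t, homOfRel] using e₂
  · intro T f g h
    obtain ⟨K, h₁, h₂⟩ := (homRel_iff _ _).1 h
    refine ⟨homOfRel (B := O) K ((hO _ _).2 ?_), hom_ext h₁, hom_ext h₂⟩
    simpa [h₁] using T.rel_p₁_p₂.map f

theorem homotopic_iff_homRel {A B : Ex C} (f g : A ⟶ B) : Homotopic f g ↔ homRel C f g := by
  constructor
  · rintro ⟨P, h, rfl, rfl⟩
    obtain ⟨k, hk, -⟩ := P.weq_r
    have hs : P.r ≫ P.s = 𝟙 B := by simpa using P.fac =≫ prod.fst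
    have ht : P.r ≫ P.t = 𝟙 B := by simpa using P.fac =≫ prod.snd
    -- For an inverse `k` of `r` up to `∼`, both `s` and `t` are `∼`-related to `k`.
    have h₁ := HomRel.comp_right P.s hk
    have h₂ := HomRel.comp_right P.t hk
    rw [Category.assoc, hs, Category.comp_id, Category.id_comp] at h₁
    rw [Category.assoc, ht, Category.comp_id, Category.id_comp] at h₂
    exact HomRel.comp_left h (Congruence.equivalence.trans (Congruence.equivalence.symm h₁) h₂)
  · intro h
    obtain ⟨P, hP⟩ := B.exists_pathObject
    obtain ⟨k, h₁, h₂⟩ := hP h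
    exact ⟨P, k, h₁, h₂⟩

end Ex

/-! ### Existence and uniqueness of transposes. -/

namespace ExpData

variable {C : Type u} [Category.{v} C] [FibWeq C] [PathCategory C] {A B : Ex C}
  (c : ExpData A B)

theorem map_eval_hom {D : Ex C} (H : D ⟶ c.exp) : (prod.map H (𝟙 B) ≫ c.eval).hom =
    prod.lift ((prod.fst : D ⨯ B ⟶ D).hom ≫ H.hom ≫ c.expProj)
      (prod.snd : D ⨯ B ⟶ B).hom ≫ c.ev := by
  have h : prod.map H (𝟙 B) = prod.lift (prod.fst ≫ H) prod.snd := by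
    apply prod.hom_ext <;> simp
  rw [h, lift_eval]
  simp

theorem exists_transpose {D : Ex C} (h : D ⨯ B ⟶ A) :
    ∃ H : D ⟶ c.exp, Ex.homRel C (prod.map H (𝟙 B) ≫ c.eval) h := by
  obtain ⟨H₀, hH₀⟩ := c.weak D.X ((Ex.prodIso D B).hom ≫ h.hom)
  have hr := Ex.Rel.of_homotopic hH₀
  -- The transpose of `H₀` is related to the morphism `h`, so it respects relations in both
  -- variables. Varying `b` lifts `H₀` to `W`; varying `d` makes the lift a morphism.
  have ht : ∀ {T : C} {d d' : T ⟶ D.X} {b b' : T ⟶ B.X}, D.Rel d d' → B.Rel b b' →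
      A.Rel (prod.lift (d ≫ H₀) b ≫ c.ev) (prod.lift (d' ≫ H₀) b' ≫ c.ev) := by
    intro T d d' b b' hd hb
    have h₁ := hr.precomp (prod.lift d b)
    have h₂ := hr.precomp (prod.lift d' b')
    simp only [prod.lift_map_assoc, Category.comp_id] at h₁ h₂
    have := (Ex.prod_rel hd hb).map h
    simp only [Category.assoc] at this
    exact (h₁.trans this).trans h₂.symm
  obtain ⟨x, hx⟩ := (c.exists_lift_k_iff H₀).2 (by
    have := ht (.refl (prod.fst : D.X ⨯ B.R ⟶ D.X)) (B.rel_p₁_p₂.precomp prod.snd)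
    rwa [prod.lift_fst_comp_snd_comp, prod.lift_fst_comp_snd_comp] at this)
  let w : D.X ⟶ c.exp.X := c.isPullbackW.lift H₀ x hx.symm
  have hp : w ≫ c.expProj = H₀ := c.isPullbackW.lift_fst H₀ x hx.symm
  let H : D ⟶ c.exp := Ex.homOfRel w (by
    rw [rel_exp_iff, Category.assoc, Category.assoc, hp]
    have := ht (D.rel_p₁_p₂.precomp (prod.fst : D.R ⨯ B.X ⟶ D.R)) (.refl prod.snd)
    rw [← prod.lift_fst_comp_snd_comp, ← prod.lift_fst_comp_snd_comp]
    simpa using this)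
  refine ⟨H, (Ex.homRel_iff_rel _ _).2 ?_⟩
  rw [map_eval_hom]
  have := hr.precomp (Ex.prodIso D B).inv
  rw [Iso.inv_hom_id_assoc, Ex.prodIso_inv, prod.lift_map_assoc, Category.comp_id] at this
  have hH : H.hom ≫ c.expProj = H₀ := hp
  rwa [hH]

theorem transpose_unique {D : Ex C} {H H' : D ⟶ c.exp}
    (h : Ex.homRel C (prod.map H (𝟙 B) ≫ c.eval) (prod.map H' (𝟙 B) ≫ c.eval)) :
    Ex.homRel C H H' := by
  rw [Ex.homRel_iff_rel, map_eval_hom, map_eval_hom] at h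
  have := h.precomp (Ex.prodIso D B).hom
  rw [Ex.homRel_iff_rel, rel_exp_iff, ← prod.lift_fst_comp_snd_comp,
    ← prod.lift_fst_comp_snd_comp]
  simpa [prod.comp_lift_assoc] using this

theorem isHomotopyExponential_eval : IsHomotopyExponential c.eval := by
  refine ⟨fun D h => ?_, fun D h H H' e e' => ?_⟩
  · obtain ⟨H, hH⟩ := c.exists_transpose h
    exact ⟨H, (Ex.homotopic_iff_homRel _ _).2 hH⟩
  · rw [Ex.homotopic_iff_homRel] at e e' ⊢
    exact c.transpose_unique (Congruence.equivalence.trans e (Congruence.equivalence.symm e'))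

end ExpData

/-! ### From exponentials to a closed structure. -/

section CartesianClosed

open MonoidalCategory CartesianMonoidalCategory

/-- A cartesian monoidal category with exponentials is closed. -/
theorem nonempty_monoidalClosed_of_isExponential {D : Type u} [Category.{v} D]
    [CartesianMonoidalCategory D] [HasBinaryProducts D]
    (h : ∀ X Y : D, ∃ (E : D) (ev : E ⨯ Y ⟶ X), IsExponential ev) :
    Nonempty (MonoidalClosed D) := by
  have hterm : ∀ Y X : D, HasTerminal (CostructuredArrow (tensorLeft Y) X) := by
    intro Y X
    obtain ⟨E, ev, hE⟩ := h X Y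
    -- An exponential is a terminal object of the comma category of `tensorLeft Y` over `X`, once
    -- the swap between `Y ⊗ A` and `A ⨯ Y` is taken into account.
    have key : ∀ {A : D} (H : A ⟶ E), (Y ◁ H) ≫ prod.lift (snd Y E) (fst Y E) ≫ ev =
        prod.lift (snd Y A) (fst Y A) ≫ prod.map H (𝟙 Y) ≫ ev := by
      intro A H
      rw [prod.lift_map_assoc, prod.comp_lift_assoc]
      simp
    have e : ∀ A : D, prod.lift (snd Y A) (fst Y A) ≫
        CartesianMonoidalCategory.lift prod.snd prod.fst = 𝟙 _ := by
      intro A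
      ext <;> simp [prod.lift_fst, prod.lift_snd]
    have e' : ∀ A : D, CartesianMonoidalCategory.lift prod.snd prod.fst ≫
        prod.lift (snd Y A) (fst Y A) = 𝟙 (A ⨯ Y) := by
      intro A
      ext <;> simp
    have uniq : ∀ A : CostructuredArrow (tensorLeft Y) X, ∃! H : A.left ⟶ E,
        (Y ◁ H) ≫ prod.lift (snd Y E) (fst Y E) ≫ ev = A.hom := by
      intro A
      obtain ⟨H, hH, hH'⟩ := hE A.left
        (CartesianMonoidalCategory.lift prod.snd prod.fst ≫ A.hom)
      refine ⟨H, ?_, fun K hK => hH' K ?_⟩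
      · dsimp only
        rw [key, hH, ← Category.assoc, e, Category.id_comp]
      · dsimp only
        rw [← hK, key, ← Category.assoc, e', Category.id_comp]
    choose H hH hH' using uniq
    exact (IsTerminal.ofUniqueHom
      (Y := CostructuredArrow.mk (S := tensorLeft Y) (prod.lift (snd Y E) (fst Y E) ≫ ev))
      (fun A => CostructuredArrow.homMk (H A) (hH A))
      (fun A m => CostructuredArrow.hom_ext _ _ (hH' A _ (CostructuredArrow.w m)))).hasTerminal
  exact ⟨⟨fun Y => ⟨_, adjunctionOfCostructuredArrowTerminals (tensorLeft Y)⟩⟩⟩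

end CartesianClosed

/-! ### Passage to the homotopy exact completion. -/

namespace Hex

section Limits

variable {C : Type u} [Category.{v} C] [FibWeq C] [PrePathCategory C]

theorem preservesLimit_pair (A B : Ex C) : PreservesLimit (pair A B) (q C) :=
  preservesLimit_of_preserves_limit_cone (Ex.prodIsLimit A B)
    ((isLimitMapConeBinaryFanEquiv _ _ _).symm (nonempty_prodIsLimit A B).some)

theorem _root_.PathCat.Ex.hasTerminal : HasTerminal (Ex C) := by
  have : HasTerminal C := PrePathCategory.hasTerminal
  have : IsIso (prod.lift (𝟙 (⊤_ C)) (𝟙 (⊤_ C))) :=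
    ⟨prod.fst, prod.lift_fst _ _, by ext⟩
  let T : Ex C := ⟨⊤_ C, ⊤_ C, 𝟙 _, 𝟙 _, .of_iff (fib_of_isIso _) (fun _ _ => True)
    (fun _ => ⟨fun _ => trivial, fun _ => trivial, fun _ _ => trivial⟩)
    (fun _ _ => iff_of_true ⟨terminal.from _, Subsingleton.elim _ _, Subsingleton.elim _ _⟩
      trivial)⟩
  exact (IsTerminal.ofUniqueHom (Y := T) (fun A => Ex.homOfRel (B := T) (terminal.from A.X)
    ⟨terminal.from _, Subsingleton.elim _ _, Subsingleton.elim _ _⟩)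
    (fun A m => Ex.hom_ext (Subsingleton.elim (α := A.X ⟶ ⊤_ C) _ _))).hasTerminal

theorem hasTerminal : HasTerminal (Hex C) :=
  have : HasTerminal (Ex C) := _root_.PathCat.Ex.hasTerminal
  (IsTerminal.ofUniqueHom (Y := (q C).obj (⊤_ (Ex C)))
    (fun A => (q C).map (terminal.from A.as))
    (fun A m => by
      obtain ⟨m, rfl⟩ := (q C).map_surjective (X := A.as) m
      exact congrArg (q C).map (Subsingleton.elim _ _))).hasTerminal

end Limits

variable {C : Type u} [Category.{v} C] [FibWeq C] [PathCategory C]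

/-- The class of the evaluation is an exponential in `Hex C`. -/
theorem exists_isExponential {A B : Ex C} (c : ExpData A B) :
    ∃ ev : (q C).obj c.exp ⨯ (q C).obj B ⟶ (q C).obj A,
      prod.lift ((q C).map prod.fst) ((q C).map prod.snd) ≫ ev = (q C).map c.eval ∧
        IsExponential ev := by
  have := fun D : Ex C => preservesLimit_pair D B
  have hev : prodComparison (q C) c.exp B ≫ inv (prodComparison (q C) c.exp B) ≫
      (q C).map c.eval = (q C).map c.eval := by simp
  refine ⟨inv (prodComparison (q C) c.exp B) ≫ (q C).map c.eval, hev, ?_⟩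
  rintro ⟨D⟩ h
  change (q C).obj D ⨯ (q C).obj B ⟶ (q C).obj A at h
  have key : ∀ H : D ⟶ c.exp, prodComparison (q C) D B ≫
      prod.map ((q C).map H) (𝟙 ((q C).obj B)) ≫
        inv (prodComparison (q C) c.exp B) ≫ (q C).map c.eval =
      (q C).map (prod.map H (𝟙 B) ≫ c.eval) := by
    intro H
    rw [← (q C).map_id B, ← prodComparison_natural_assoc, hev, Functor.map_comp]
  -- Every map of `Hex C` has a representative in `Ex C`, where transposes are already available;
  -- `prodComparison` identifies the two products.
  obtain ⟨h', hh'⟩ := (q C).map_surjective (prodComparison (q C) D B ≫ h)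
  obtain ⟨H, hH⟩ := c.exists_transpose h'
  have eH : prod.map ((q C).map H) (𝟙 ((q C).obj B)) ≫
      inv (prodComparison (q C) c.exp B) ≫ (q C).map c.eval = h := by
    rw [← cancel_epi (prodComparison (q C) D B), key, ← hh']
    exact (q_eq_iff _ _).2 hH
  refine ⟨(q C).map H, eH, fun K hK => ?_⟩
  obtain ⟨K, rfl⟩ := (q C).map_surjective (X := D) (Y := c.exp) K
  refine (q_eq_iff _ _).2 (c.transpose_unique ((q_eq_iff _ _).1 ?_))
  rw [← key, ← key, eH]
  exact congrArg _ hK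

end Hex

end PathCat

open PathCat

theorem mainTheorem10 {C : Type u} [Category.{v} C] [FibWeq C] [PathCategory C]
    (hPi : HasWeakHomotopyPi C) :
    HasHomotopyExponentials (Ex C) ∧
    (∃ _ : CartesianMonoidalCategory (Hex C), Nonempty (MonoidalClosed (Hex C))) ∧
    ∀ A B : Ex C, Nonempty (ExpData A B) ∧
      ∀ c : ExpData A B, ∃ (hQ : IsHomotopyEquivRel c.q₁ c.q₂) (ev : c.obj hQ ⨯ B ⟶ A),
        ev.hom = prod.lift ((prod.fst : c.obj hQ ⨯ B ⟶ c.obj hQ).hom ≫ c.p)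
          (prod.snd : c.obj hQ ⨯ B ⟶ B).hom ≫ c.ev ∧
        IsHomotopyExponential ev ∧
        ∃ ev' : (Hex.q C).obj (c.obj hQ) ⨯ (Hex.q C).obj B ⟶ (Hex.q C).obj A,
          prod.lift ((Hex.q C).map prod.fst) ((Hex.q C).map prod.snd) ≫ ev' =
            (Hex.q C).map ev ∧
          IsExponential ev' := by
  refine ⟨fun A B => ?_, ?_, fun A B => ⟨nonempty_expData hPi A B, fun c =>
    ⟨c.isHomotopyEquivRel, c.eval, rfl, c.isHomotopyExponential_eval,
      Hex.exists_isExponential c⟩⟩⟩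
  · obtain ⟨c⟩ := nonempty_expData hPi A B
    exact ⟨c.exp, c.eval, c.isHomotopyExponential_eval⟩
  · have : HasTerminal (Hex C) := Hex.hasTerminal
    have := hasFiniteProducts_of_has_binary_and_terminal (C := Hex C)
    refine ⟨.ofHasFiniteProducts, ?_⟩
    let : CartesianMonoidalCategory (Hex C) := .ofHasFiniteProducts
    refine nonempty_monoidalClosed_of_isExponential ?_
    rintro ⟨A⟩ ⟨B⟩
    obtain ⟨c⟩ := nonempty_expData hPi A B
    obtain ⟨ev, -, h⟩ := Hex.exists_isExponential c
    exact ⟨_, ev, h⟩
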